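/- Let $\mathbb{K}$ be a field, $d\ge 0$ and $\mathbf m=(m_1,\dots,m_d)\in\mathbb{N}_0^d$. Let $P=\mathbb{K}[x_{i,j} : 1\le i\le d,\ 1\le j\le m_i]$ and $P'=\mathbb{K}[x_{i,j} : 1\le i\le d,\ 1\le j\le m_i+1]$, where $P'$ has the fine $\mathbb{Z}^{d+|\mathbf m|}$-grading, $|\mathbf m|=m_1+\cdots+m_d$, in which $\deg x_{i,j}$ is the corresponding standard basis vector. A monomial of $P$ is *color-squarefree* if it is squarefree and, for each $i$, divisible by at most one of the variables $x_{i,1},\dots,x_{i,m_i}$; let $[\mathrm{Mon}_{cs}(P)]_k$ be the set of color-squarefree monomials of total degree $k$. For such a monomial $u$, let $\mathrm{cSupp}(u)$ be the set of all $i$ such that some $x_{i,j}$ divides $u$, and let $\tau(u)=\deg\bigl(u\prod_{i\in \mathrm{cSupp}(u)}x_{i,m_i+1}\bigr)\in\mathbb{Z}^{d+|\mathbf m|}$. A monomial ideal of $P$ is *color-squarefree* if all its minimal monomial generators are color-squarefree. Let $I\subset P$ be a color-squarefree monomial ideal and consider the ideals of $P'$ $$Q=(x_{i,j}x_{i,k}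 : 1\le i\le d,\ 1\le j<k\le m_i),\qquad I'=IP'+Q,\qquad L=(x_{i,m_i+1}x_{i,j} : 1\le i\le d,\ 1\le j\le m_i).$$ (a) There is an exact sequence of $\mathbb{Z}^{d+|\mathbf m|}$-graded $P'$-modules $$0\to G_d\to\cdots\to G_1\to G_0=P'/I'\to P'/(I'+L)\to 0,\qquad G_k=\bigoplus_{u\in[\mathrm{Mon}_{cs}(P)]_k}\bigl(P'/(I':u)\bigr)(-\tau(u)),$$ where $G_0\to P'/(I'+L)$ is the canonical projection and, for $u=x_{i_1,j_1}\cdots x_{i_k,j_k}$ with $i_1<\cdots<i_k$, the map $G_k\to G_{k-1}$ sends the class of $f$ in the summand of $u$ to the element whose component in the summand of $u/x_{i_l,j_l}$ is the class of $(-1)^{l-1}x_{i_l,j_l}x_{i_l,m_{i_l}+1}f$ for $l=1,\dots,k$, and whose other components are zero. These maps are induced, via the canonical projections $P'/(Q:u)\to P'/(I':u)$, by the maps of the corresponding sequence for $I=0$ (that is, with $Q$ in place of $I'$). (b) $P'/(I'+L)$ is minimally resolved over $P'$ by iterated mapping cones from this sequence: every $G_k$ has a minimal graded free resolution, and for every choice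 of minimal graded free resolutions $R^{(k)}$ of $G_k$ ($0\le k\le d$), one can start with $C^{(d)}=R^{(d)}$ and successively for $k=d-1,\dots,0$ choose a homogeneous chain map $C^{(k+1)}\to R^{(k)}$ of degree zero that lifts $G_{k+1}\to G_k$ and let $C^{(k)}$ be its mapping cone; and for every such choice, $C^{(0)}$ is a minimal graded free resolution of $P'/(I'+L)$. (c) For every $k\ge 0$ and $a\in\mathbb{Z}^{d+|\mathbf m|}$, $$\beta_{k,a}\bigl(P'/(I'+L)\bigr)=\sum_{j=0}^{d}\ \sum_{u\in[\mathrm{Mon}_{cs}(P)]_j}\beta_{k-j,\,a-\tau(u)}\bigl(P'/(I':u)\bigr),$$ where $\beta_{k,a}(M)$ denotes the number of generators of degree $a$ in homological degree $k$ of a minimal graded free resolution of $M$ (each of the modules involved has such a resolution, and the number does not depend on its choice), and $\beta_{k,a}(M)=0$ for $k<0$. -/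

import Mathlib

open MvPolynomial

noncomputable section

/-! ## Multigraded modules over a polynomial ring and minimal graded free resolutions -/

namespace Multigraded

variable {K : Type*} [Field K] {V : Type*} [DecidableEq V]

/-- The homogeneous component of degree `a ∈ ℤ^V` of the polynomial ring `K[V]` for the fine grading,
in which the degree of a variable is the corresponding standard basis vector. -/
def polyPart (K : Type*) [Field K] (a : V → ℤ) : AddSubgroup (MvPolynomial V K) :=
  (weightedHomogeneousSubmodule K (fun v : V => (Pi.single v 1 : V → ℤ)) a).toAddSubgroup

/-- The degree in `ℤ^V` of the monomial with exponent vector `e`. -/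
def expDeg (e : V →₀ ℕ) : V → ℤ := fun v => (e v : ℤ)

open Classical in
/-- The family `gr` of subgroups turns `M` into a `ℤ^V`-graded module over `K[V]`. -/
structure IsGrading (K : Type*) [Field K] {V : Type*} {M : Type*} [AddCommGroup M] [Module (MvPolynomial V K) M]
    (gr : (V → ℤ) → AddSubgroup M) : Prop where
  internal : DirectSum.IsInternal gr
  smul_mem : ∀ (a b : V → ℤ) (p : MvPolynomial V K) (x : M),
    p ∈ polyPart K a → x ∈ gr b → p • x ∈ gr (a + b)

/-- A map which is homogeneous of degree zero. -/
def PreservesDegree {M N : Type*} [AddCommGroup M] [AddCommGroup N]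
    (grM : (V → ℤ) → AddSubgroup M) (grN : (V → ℤ) → AddSubgroup N) (f : M → N) : Prop :=
  ∀ (a : V → ℤ) (x : M), x ∈ grM a → f x ∈ grN a

/-- The grading of `(K[V] / J)(-c)`: its component of degree `a` is the image of the component
of degree `a - c` of the polynomial ring. -/
def cyclicGrading (J : Ideal (MvPolynomial V K)) (c : V → ℤ) :
    (V → ℤ) → AddSubgroup (MvPolynomial V K ⧸ J) :=
  fun a => (polyPart K (a - c)).map (Ideal.Quotient.mk J).toAddMonoidHom

/-- The grading of a finite direct sum (written as a product) of graded modules. -/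
def piGrading {ι : Type*} {M : ι → Type*} [∀ i, AddCommGroup (M i)]
    (gr : ∀ i, (V → ℤ) → AddSubgroup (M i)) : (V → ℤ) → AddSubgroup (∀ i, M i) :=
  fun a =>
    { carrier := {x | ∀ i, x i ∈ gr i a}
      zero_mem' := fun i => (gr i a).zero_mem
      add_mem' := fun hx hy i => (gr i a).add_mem (hx i) (hy i)
      neg_mem' := fun hx i => (gr i a).neg_mem (hx i) }

/-- The grading of the free module `⊕_b K[V](-deg b)`. -/
def freeGrading (K : Type*) [Field K] {ι : Type*} (deg : ι → V → ℤ) :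
    (V → ℤ) → AddSubgroup (ι → MvPolynomial V K) :=
  piGrading (fun b a => polyPart K (a - deg b))

/-- A complex `⋯ → F₂ → F₁ → F₀` of finitely generated `ℤ^V`-graded free modules
`Fₙ = ⊕_{b ∈ ι n} K[V](-deg b)`, with differentials that are homogeneous of degree zero. -/
structure FreeComplex (K : Type*) [Field K] (V : Type*) [DecidableEq V] where
  ι : ℕ → Type
  finite : ∀ n, Finite (ι n)
  deg : ∀ n, ι n → V → ℤ
  d : ∀ n, (ι (n + 1) → MvPolynomial V K) →ₗ[MvPolynomial V K] (ι n → MvPolynomial V K)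
  d_homogeneous : ∀ n,
    PreservesDegree (freeGrading K (deg (n + 1))) (freeGrading K (deg n)) (d n)
  d_comp_d : ∀ n x, d n (d (n + 1) x) = 0

namespace FreeComplex

/-- The `n`-th free module of the complex. -/
abbrev X (C : FreeComplex K V) (n : ℕ) : Type _ := C.ι n → MvPolynomial V K

/-- The grading of the `n`-th free module. -/
abbrev gr (C : FreeComplex K V) (n : ℕ) : (V → ℤ) → AddSubgroup (C.X n) :=
  freeGrading K (C.deg n)

/-- The number of basis elements of degree `a` in homological degree `n`. -/
def rank (C : FreeComplex K V) (n : ℕ) (a : V → ℤ) : ℕ :=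
  Nat.card {b : C.ι n // C.deg n b = a}

/-- The image of every differential lies in the maximal ideal generated by the variables times
the target. -/
def IsMinimal (C : FreeComplex K V) : Prop :=
  ∀ (n : ℕ) (x : C.X (n + 1)) (b : C.ι n), constantCoeff (C.d n x b) = 0

/-- A chain map, homogeneous of degree zero. -/
structure Hom (C D : FreeComplex K V) where
  f : ∀ n, C.X n →ₗ[MvPolynomial V K] D.X n
  f_homogeneous : ∀ n, PreservesDegree (C.gr n) (D.gr n) (f n)
  comm : ∀ n x, f n (C.d n x) = D.d n (f (n + 1) x)

/-- The index sets of the bases of the mapping cone of a map `C → D`. -/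
def coneι (C D : FreeComplex K V) : ℕ → Type
  | 0 => D.ι 0
  | n + 1 => D.ι (n + 1) ⊕ C.ι n

/-- The degrees of the basis elements of the mapping cone of a map `C → D`. -/
def coneDeg (C D : FreeComplex K V) : ∀ n, coneι C D n → V → ℤ
  | 0 => D.deg 0
  | n + 1 => Sum.elim (D.deg (n + 1)) (C.deg n)

/-- The differential of the mapping cone: `(y, x) ↦ (d y + φ x, - d x)`. -/
def coneD {C D : FreeComplex K V} (φ : Hom C D) : ∀ n,
    (coneι C D (n + 1) → MvPolynomial V K) →ₗ[MvPolynomial V K]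
      (coneι C D n → MvPolynomial V K)
  | 0 =>
    (D.d 0).comp (LinearMap.funLeft _ _ Sum.inl) + (φ.f 0).comp (LinearMap.funLeft _ _ Sum.inr)
  | n + 1 =>
    ((LinearEquiv.sumArrowLequivProdArrow (D.ι (n + 1)) (C.ι n) (MvPolynomial V K)
        (MvPolynomial V K)).symm.toLinearMap).comp
      (LinearMap.prod
        ((D.d (n + 1)).comp (LinearMap.funLeft _ _ Sum.inl) +
          (φ.f (n + 1)).comp (LinearMap.funLeft _ _ Sum.inr))
        (-(C.d n).comp (LinearMap.funLeft _ _ Sum.inr)))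

/-- The mapping cone of a map `φ : C → D` of complexes of graded free modules: the complex with
modules `D₀` and `D_{n+1} ⊕ Cₙ` and differential `(y, x) ↦ (d y + φ x, - d x)`. -/
def cone {C D : FreeComplex K V} (φ : Hom C D) : FreeComplex K V where
  ι := coneι C D
  finite n := by
    have := C.finite
    have := D.finite
    cases n <;> simp only [coneι] <;> infer_instance
  deg := coneDeg C D
  d := coneD φ
  d_homogeneous n := by
    cases n with
    | zero =>
      intro a x hx b
      exact add_mem
        (D.d_homogeneous 0 a (fun c => x (Sum.inl c)) (fun c => hx (Sum.inl c)) b)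
        (φ.f_homogeneous 0 a (fun c => x (Sum.inr c)) (fun c => hx (Sum.inr c)) b)
    | succ n =>
      intro a x hx b
      rcases b with b | b
      · exact add_mem
          (D.d_homogeneous (n + 1) a (fun c => x (Sum.inl c))
            (fun c => hx (Sum.inl c)) b)
          (φ.f_homogeneous (n + 1) a (fun c => x (Sum.inr c))
            (fun c => hx (Sum.inr c)) b)
      · exact neg_mem
          (C.d_homogeneous n a (fun c => x (Sum.inr c)) (fun c => hx (Sum.inr c)) b)
  d_comp_d n x := by
    have key : ∀ (n : ℕ) (y : D.X (n + 2)) (z : C.X (n + 1)),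
        D.d n (D.d (n + 1) y + φ.f (n + 1) z) + φ.f n (-C.d n z) = 0 := by
      intro n y z
      rw [map_add, D.d_comp_d, map_neg, φ.comm, zero_add, add_neg_cancel]
    cases n with
    | zero => exact key 0 (fun c => x (Sum.inl c)) (fun c => x (Sum.inr c))
    | succ n =>
      funext b
      rcases b with b | b
      · exact congrFun (key (n + 1) (fun c => x (Sum.inl c)) (fun c => x (Sum.inr c))) b
      · have h : -C.d n (-C.d (n + 1) (fun c => x (Sum.inr c))) = 0 := by
          rw [map_neg, C.d_comp_d, neg_zero, neg_zero]
        exact congrFun h b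

end FreeComplex

/-- The augmented complex `⋯ → C₁ → C₀ → M → 0` is exact, with `ε : C₀ → M` homogeneous of degree
zero; that is, it is a graded free resolution of `M`. -/
structure IsResolution (C : FreeComplex K V) {M : Type*} [AddCommGroup M]
    [Module (MvPolynomial V K) M] (gr : (V → ℤ) → AddSubgroup M)
    (ε : C.X 0 →ₗ[MvPolynomial V K] M) : Prop where
  homogeneous : PreservesDegree (C.gr 0) gr ε
  surjective : Function.Surjective ε
  exact_zero : Function.Exact (C.d 0) ε
  exact_succ : ∀ n, Function.Exact (C.d (n + 1)) (C.d n)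

/-- A minimal graded free resolution of the graded module `M`. -/
structure MinimalResolution (K : Type*) [Field K] {V : Type*} [DecidableEq V] {M : Type*} [AddCommGroup M] [Module (MvPolynomial V K) M]
    (gr : (V → ℤ) → AddSubgroup M) where
  complex : FreeComplex K V
  aug : complex.X 0 →ₗ[MvPolynomial V K] M
  isResolution : IsResolution complex gr aug
  isMinimal : complex.IsMinimal

open Classical in
/-- The multigraded Betti number `β_{n,a}(M)`: the number of generators of degree `a` in
homological degree `n` of a minimal graded free resolution of `M`. -/
def betti (K : Type*) [Field K] {V : Type*} [DecidableEq V] {M : Type*} [AddCommGroup M] [Module (MvPolynomial V K) M]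
    (gr : (V → ℤ) → AddSubgroup M) (n : ℕ) (a : V → ℤ) : ℕ :=
  if h : Nonempty (MinimalResolution K gr) then h.some.complex.rank n a else 0

/-- Let `G_d → ⋯ → G₁ → G₀` be a sequence of graded modules with maps `δ k : G_{k+1} → G_k`, and let
`R k` be a minimal graded free resolution of `G_k`. The predicate `IteratedCone δ R d k C ε` says that
the complex `C` of graded free modules, with augmentation `ε : C₀ → G_k`, arises from
the resolutions `R d, …, R k` by iterated mapping cones: one starts with `R d`; if `C` is
a complex obtained from `R d, …, R (k+1)`, then one chooses a homogeneous chain map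
`φ : C → R k` which lifts `δ k : G_{k+1} → G_k` and passes to the mapping cone of `φ`. -/
inductive IteratedCone {G : ℕ → Type*} [∀ k, AddCommGroup (G k)]
    [∀ k, Module (MvPolynomial V K) (G k)] {gr : ∀ k, (V → ℤ) → AddSubgroup (G k)}
    (δ : ∀ k, G (k + 1) →ₗ[MvPolynomial V K] G k) (R : ∀ k, MinimalResolution K (gr k)) (d : ℕ) :
    ∀ (k : ℕ) (C : FreeComplex K V), (C.X 0 →ₗ[MvPolynomial V K] G k) → Prop
  | base : IteratedCone δ R d d (R d).complex (R d).aug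
  | step {k : ℕ} {C : FreeComplex K V} {ε : C.X 0 →ₗ[MvPolynomial V K] G (k + 1)}
      (h : IteratedCone δ R d (k + 1) C ε) (φ : FreeComplex.Hom C (R k).complex)
      (hφ : ∀ x, (R k).aug (φ.f 0 x) = δ k (ε x)) :
      IteratedCone δ R d k (FreeComplex.cone φ) (R k).aug

end Multigraded

/-! ## Color-squarefree monomial ideals -/

namespace Colored

open Multigraded

variable {K : Type*} [Field K] {d : ℕ} {m : Fin d → ℕ}

/-- The variables `x_{i,j}` with `1 ≤ i ≤ d`, `1 ≤ j ≤ m_i`; here `i` is the color. -/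
abbrev Var (m : Fin d → ℕ) : Type := Σ i : Fin d, Fin (m i)

/-- The vector `m + (1,…,1)`. -/
abbrev succVec (m : Fin d → ℕ) : Fin d → ℕ := fun i => m i + 1

/-- The polynomial ring `P(d, m)`. -/
abbrev P (K : Type*) [Field K] (m : Fin d → ℕ) : Type _ := MvPolynomial (Var m) K

/-- The polynomial ring `P' = P(d, m + (1,…,1))`. -/
abbrev P' (K : Type*) [Field K] (m : Fin d → ℕ) : Type _ := MvPolynomial (Var (succVec m)) K

/-- The variable `x_{i,j}` of `P`, as a variable of `P'`. -/
def old (e : Var m) : Var (succVec m) := ⟨e.1, e.2.castSucc⟩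

/-- The additional variable `x_{i, m_i + 1}` of `P'`. -/
def new (m : Fin d → ℕ) (i : Fin d) : Var (succVec m) := ⟨i, Fin.last (m i)⟩

/-- A monomial (given by its exponent vector) is color-squarefree if it is squarefree and divisible
by at most one variable of each color. -/
def IsColorSquarefree (u : Var m →₀ ℕ) : Prop :=
  (∀ e, u e ≤ 1) ∧ ∀ (i : Fin d) (j k : Fin (m i)), u ⟨i, j⟩ ≠ 0 → u ⟨i, k⟩ ≠ 0 → j = k

/-- A color-squarefree monomial ideal: an ideal generated by monomials whose minimal monomial
generators, i.e. the monomials in it that are minimal with respect to divisibility, are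
color-squarefree. -/
def IsColorSquarefreeIdeal (I : Ideal (P K m)) : Prop :=
  (∃ A : Set (Var m →₀ ℕ), I = Ideal.span ((fun u => monomial u (1 : K)) '' A)) ∧
    ∀ u : Var m →₀ ℕ, Minimal (fun w => monomial w (1 : K) ∈ I) u → IsColorSquarefree u

/-- The color-squarefree monomials of `P` of total degree `k`. -/
abbrev MonCS (m : Fin d → ℕ) (k : ℕ) : Type :=
  {u : Var m →₀ ℕ // IsColorSquarefree u ∧ u.degree = k}

instance (k : ℕ) : Finite (MonCS m k) := by
  refine Finite.of_injective
    (fun (u : MonCS m k) (e : Var m) => (⟨u.1 e, Nat.lt_succ_of_le (u.2.1.1 e)⟩ : Fin 2)) ?_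
  intro u v h
  refine Subtype.ext (Finsupp.ext fun e => ?_)
  exact congrArg Fin.val (congrFun h e)

instance (k : ℕ) : Fintype (MonCS m k) := Fintype.ofFinite _

/-- The color support of a monomial. -/
def cSupp (u : Var m →₀ ℕ) : Finset (Fin d) := u.support.image Sigma.fst

/-- A monomial of `P`, as an element of `P'`. -/
def mono' (K : Type*) [Field K] (u : Var m →₀ ℕ) : P' K m := monomial (u.mapDomain old) 1

/-- The exponent vector of the monomial `u ∏_{i ∈ cSupp u} x_{i, m_i + 1}` of `P'`. -/
def shiftExp (u : Var m →₀ ℕ) : Var (succVec m) →₀ ℕ :=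
  u.mapDomain old + ∑ i ∈ cSupp u, Finsupp.single (new m i) 1

/-- The degree in `ℤ^{d + |m|}` of `u ∏_{i ∈ cSupp u} x_{i, m_i + 1}`. -/
def shiftDeg (u : Var m →₀ ℕ) : Var (succVec m) → ℤ := expDeg (shiftExp u)

/-- The ideal `𝔪₁^{[2]} + ⋯ + 𝔪_d^{[2]}` of `P'`, generated by all `x_{i,j} x_{i,k}` with
`1 ≤ j < k ≤ m_i`. -/
def polSquares (K : Type*) [Field K] (m : Fin d → ℕ) : Ideal (P' K m) :=
  Ideal.span {f | ∃ (i : Fin d) (j k : Fin (m i)), j < k ∧ f = X (old ⟨i, j⟩) * X (old ⟨i, k⟩)}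

/-- The ideal `∑ x_{i, m_i + 1} 𝔪_i` of `P'`, generated by all `x_{i, m_i + 1} x_{i,j}` with
`1 ≤ j ≤ m_i`. -/
def newIdeal (K : Type*) [Field K] (m : Fin d → ℕ) : Ideal (P' K m) :=
  Ideal.span {f | ∃ (i : Fin d) (j : Fin (m i)), f = X (new m i) * X (old ⟨i, j⟩)}

/-- The ideal `I' = I + 𝔪₁^{[2]} + ⋯ + 𝔪_d^{[2]}` of `P'`. -/
def primeIdeal (I : Ideal (P K m)) : Ideal (P' K m) :=
  I.map (rename (old : Var m → Var (succVec m)) : P K m →ₐ[K] P' K m) ⊔ polSquares K m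

/-- The colon ideal `J : u` in `P'`, for a monomial `u` of `P`. -/
def colonMon (J : Ideal (P' K m)) (u : Var m →₀ ℕ) : Ideal (P' K m) :=
  Submodule.colon J {mono' K u}

/-- The module `G_k = ⊕_u P'/(J : u)`, where `u` ranges over the color-squarefree monomials
of `P` of total degree `k`. -/
abbrev G (J : Ideal (P' K m)) (k : ℕ) : Type _ := ∀ u : MonCS m k, P' K m ⧸ colonMon J u.1

/-- The grading of `G_k = ⊕_u (P'/(J : u))(-deg (u ∏_{i ∈ cSupp u} x_{i, m_i + 1}))`. -/
def grG (J : Ideal (P' K m)) (k : ℕ) :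
    (Var (succVec m) → ℤ) → AddSubgroup (G J k) :=
  piGrading (fun u : MonCS m k => cyclicGrading (colonMon J u.1) (shiftDeg u.1))

/-- If `u = x_{i,j} v`, this is the map `P'/(J : u) → P'/(J : v)` induced by multiplication by
`x_{i,j} x_{i, m_i + 1}`. -/
def mulMap (J : Ideal (P' K m)) (u v : Var m →₀ ℕ) (e : Var m) (h : u = v + Finsupp.single e 1) :
    (P' K m ⧸ colonMon J u) →ₗ[P' K m] (P' K m ⧸ colonMon J v) :=
  Submodule.mapQ (colonMon J u) (colonMon J v)
    (LinearMap.mulLeft (P' K m) (X (old e) * X (new m e.1))) (by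
      intro f hf
      simp only [colonMon, Submodule.mem_comap, Submodule.mem_colon_singleton, smul_eq_mul,
        LinearMap.mulLeft_apply] at hf ⊢
      have h1 : mono' K u = X (old e) * mono' K v := by
        rw [h, mono', mono', Finsupp.mapDomain_add, Finsupp.mapDomain_single, X, monomial_mul,
          mul_one, add_comm]
      have h2 : X (old e) * X (new m e.1) * f * mono' K v = X (new m e.1) * (f * mono' K u) := by
        rw [h1]; ring
      rw [h2]
      exact J.mul_mem_left _ hf)

open Classical in
/-- The map `G_{k+1} → G_k`. On the summand of `u = x_{i_0,j_0} ⋯ x_{i_k,j_k}`, `i_0 < ⋯ < i_k`, it is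
the sum over `l` of the maps to the summands of `u / x_{i_l,j_l}` that are induced by
multiplication by `(-1)^l x_{i_l,j_l} x_{i_l, m_{i_l} + 1}`. (The sign is the one of the tensor
product of `d` complexes of length one.) -/
def diff (J : Ideal (P' K m)) (k : ℕ) : G J (k + 1) →ₗ[P' K m] G J k :=
  LinearMap.pi fun v : MonCS m k =>
    ∑ u : MonCS m (k + 1), ∑ e : Var m,
      if h : u.1 = v.1 + Finsupp.single e 1 then
        ((-1 : P' K m) ^ ((cSupp u.1).filter (fun i => i < e.1)).card) •
          (mulMap J u.1 v.1 e h).comp (LinearMap.proj u)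
      else 0

/-- The monomial `1`. -/
def oneMon (m : Fin d → ℕ) : MonCS m 0 := ⟨0, ⟨by simp, by simp⟩, by simp⟩

/-- The canonical projection `G_0 = P'/J → P'/(J + ∑ x_{i, m_i + 1} 𝔪_i)`. Note that `G_0` has just one
summand, for `u = 1`, and that `J : 1 = J`. -/
def augG (J : Ideal (P' K m)) : G J 0 →ₗ[P' K m] (P' K m ⧸ (J ⊔ newIdeal K m)) :=
  (Submodule.mapQ (colonMon J (oneMon m).1) (J ⊔ newIdeal K m) LinearMap.id (by
    intro f hf
    simp only [colonMon, Submodule.mem_colon_singleton, oneMon, mono', Finsupp.mapDomain_zero,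
      smul_eq_mul] at hf
    rw [← C_apply, C_1, mul_one] at hf
    exact Ideal.mem_sup_left hf)).comp (LinearMap.proj (oneMon m))

/-- For ideals `J₁ ⊆ J₂`, the map `⊕_u P'/(J₁ : u) → ⊕_u P'/(J₂ : u)` formed by the canonical
projections. -/
def projG {J₁ J₂ : Ideal (P' K m)} (h : J₁ ≤ J₂) (k : ℕ) : G J₁ k →ₗ[P' K m] G J₂ k :=
  LinearMap.pi fun u : MonCS m k =>
    (Submodule.mapQ (colonMon J₁ u.1) (colonMon J₂ u.1) LinearMap.id
      (Submodule.colon_mono h subset_rfl)).comp (LinearMap.proj u)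

lemma polSquares_le_primeIdeal (I : Ideal (P K m)) : polSquares K m ≤ primeIdeal I := le_sup_right

end Colored

end

open Multigraded Colored

/-!
Write `I'` for `primeIdeal I`, `Q` for `polSquares K m`, `L` for `newIdeal K m` and `τ` for `shiftDeg`.

The sequence is exact because it is so in every degree `a` of the fine grading. Nonzero elements
occur only if `a` is the degree of a monomial `x^a`. If `x^a` lies in `I'`, all modules `G_k`
vanish in degree `a`, because `I'` is extended from `P`, so that membership does not depend on the
additional variables (`Colored.ofChain_eq_zero_iff`). Otherwise `x^a` involves at most one
variable of `P` of each color, since `I'` contains `Q`, and the part of `G_k` of degree `a` has a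
basis that is indexed by the `k`-element subsets of the set `T` of all colors `i` such that `x^a`
is divisible by a variable of `P` of color `i` and by the additional variable of color `i`. The
sequence is then the augmented chain complex of the simplex on `T`: it is contracted by the
insertion of the first element of `T` (`Colored.IsPivot.boundary_contraction`), and if `T` is
empty, then only `G_0` is left, and `x^a` is not in `L`.

For the resolutions, the general theory is developed for modules with a fine grading: existence of
minimal resolutions (`Multigraded.exists_minimalResolution`), comparison maps
(`Multigraded.exists_hom`), independence of the Betti numbers of the minimal resolution
(`Multigraded.rank_eq_betti`), and exactness of iterated mapping cones
(`Multigraded.IteratedCone.resolves`). The iterated mapping cones are minimal for every choice of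
lifts for reasons of degree: the additional variables are regular on the modules `P' / (I' : u)`,
which are generated in degree zero, so that the degrees in a minimal resolution of `P' / (I' : u)`
do not involve them (`Multigraded.MinimalResolution.deg_apply_eq_zero`). Since `τ(u)` has total
degree `k` in the additional variables if `u` has degree `k`, all basis elements of a minimal
resolution of `G_k` have total degree `k` in them (`Colored.sum_deg_new`). A homogeneous map of
degree zero has unit entries only between basis elements of equal degree; a lift of
`G_{k+1} → G_k` therefore has none. The formula for the Betti numbers counts the basis of the
minimal resolution obtained in this way.
-/

noncomputable section

namespace Multigraded

/-! ### Internal gradings -/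

section Internal

variable {A M N : Type*} [AddCommGroup M] [AddCommGroup N]

/-- The components of a sum of homogeneous elements in the external direct sum. -/
theorem directSum_sum_of_apply [DecidableEq A] (gr : A → AddSubgroup M) (s : Finset A) (y : A → M)
    (hy : ∀ a, y a ∈ gr a) (b : A) (hb : b ∈ s) :
    ((∑ a ∈ s, DirectSum.of (fun a => gr a) a ⟨y a, hy a⟩ : DirectSum A fun a => gr a) b : M)
      = y b := by
  rw [DFinsupp.finsetSum_apply, AddSubgroup.val_finsetSum, Finset.sum_eq_single b]
  · rw [DirectSum.of_eq_same]
  · intro c _ hc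
    rw [DirectSum.of_eq_of_ne _ _ _ hc.symm]; rfl
  · exact fun h => absurd hb h

/-- A family of subgroups is internal as soon as it generates and admits no nontrivial finite
relation. -/
theorem isInternal_of [DecidableEq A] {gr : A → AddSubgroup M} (h1 : ∀ x, x ∈ ⨆ a, gr a)
    (h2 : ∀ (s : Finset A) (y : A → M), (∀ a, y a ∈ gr a) → ∑ a ∈ s, y a = 0 →
      ∀ a ∈ s, y a = 0) : DirectSum.IsInternal gr := by
  constructor
  · rw [injective_iff_map_eq_zero]
    intro z hz
    classical
    rw [DirectSum.coeAddMonoidHom_eq_dfinsuppSum, DFinsupp.sum] at hz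
    ext a
    by_cases ha : a ∈ z.support
    · exact h2 z.support (fun a => z a) (fun a => (z a).2) hz a ha
    · rw [DFinsupp.notMem_support_iff.1 ha]
      rfl
  · intro x
    have : (⨆ a, gr a) ≤ (DirectSum.coeAddMonoidHom gr).range := by
      refine iSup_le fun a y hy => ?_
      exact ⟨DirectSum.of (fun a => gr a) a ⟨y, hy⟩, DirectSum.coeAddMonoidHom_of _ _ _⟩
    exact this (h1 x)

/-- Every element is a finite sum of homogeneous elements. -/
theorem exists_sum_of_isInternal [DecidableEq A] {gr : A → AddSubgroup M}
    (h : DirectSum.IsInternal gr) (x : M) :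
    ∃ (s : Finset A) (y : A → M), (∀ a, y a ∈ gr a) ∧ ∑ a ∈ s, y a = x := by
  classical
  obtain ⟨z, rfl⟩ := h.2 x
  exact ⟨z.support, fun a => z a, fun a => (z a).2,
    by rw [DirectSum.coeAddMonoidHom_eq_dfinsuppSum, DFinsupp.sum]⟩

/-- A finite sum of elements of different degrees vanishes only if all of them do. -/
theorem eq_zero_of_isInternal [DecidableEq A] {gr : A → AddSubgroup M}
    (h : DirectSum.IsInternal gr) (s : Finset A) (y : A → M) (hy : ∀ a, y a ∈ gr a)
    (h0 : ∑ a ∈ s, y a = 0) : ∀ a ∈ s, y a = 0 := by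
  intro a ha
  have : (∑ a ∈ s, DirectSum.of (fun a => gr a) a ⟨y a, hy a⟩ : DirectSum A fun a => gr a) = 0 := by
    apply h.1
    rw [map_sum, map_zero, ← h0]
    exact Finset.sum_congr rfl fun b _ => DirectSum.coeAddMonoidHom_of _ _ _
  rw [← directSum_sum_of_apply gr s y hy a ha, this]
  rfl

/-- The kernel of a homogeneous map is generated by homogeneous elements. -/
theorem mem_iSup_ker_of_isInternal [DecidableEq A] {grM : A → AddSubgroup M}
    {grN : A → AddSubgroup N} (hM : DirectSum.IsInternal grM) (hN : DirectSum.IsInternal grN)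
    (f : M →+ N) (hf : ∀ a x, x ∈ grM a → f x ∈ grN a) {x : M} (hx : f x = 0) :
    x ∈ ⨆ a, grM a ⊓ f.ker := by
  obtain ⟨s, y, hy, rfl⟩ := exists_sum_of_isInternal hM x
  rw [map_sum] at hx
  have := eq_zero_of_isInternal hN s (fun a => f (y a)) (fun a => hf a _ (hy a)) hx
  exact sum_mem fun a ha => (le_iSup (fun a => grM a ⊓ f.ker) a) ⟨hy a, this a ha⟩

/-- A homogeneous element in the image of a homogeneous map is the image of a homogeneous
element. -/
theorem exists_homogeneous_preimage [DecidableEq A] {grM : A → AddSubgroup M}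
    {grN : A → AddSubgroup N} (hM : DirectSum.IsInternal grM) (hN : DirectSum.IsInternal grN)
    (f : M →+ N) (hf : ∀ a x, x ∈ grM a → f x ∈ grN a) (x : M) {a : A} (hx : f x ∈ grN a) :
    ∃ y ∈ grM a, f y = f x := by
  obtain ⟨s, y, hy, rfl⟩ := exists_sum_of_isInternal hM x
  classical
  -- The differences of the components of `f (∑ y)`, as a sum of the `f (y b)` and as a single
  -- element of degree `a`; they add up to zero.
  let z : A → N := fun b => f (if b ∈ s then y b else 0) - if b = a then f (∑ b ∈ s, y b) else 0
  have hz : ∀ b, z b ∈ grN b := by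
    intro b
    refine sub_mem (hf _ _ ?_) ?_
    · split_ifs
      exacts [hy b, zero_mem _]
    · split_ifs with h
      exacts [h ▸ hx, zero_mem _]
  have hz0 : ∑ b ∈ insert a s, z b = 0 := by
    simp only [z]
    rw [Finset.sum_sub_distrib, Finset.sum_ite_eq', if_pos (Finset.mem_insert_self _ _),
      sub_eq_zero, map_sum]
    rw [← Finset.sum_subset (Finset.subset_insert a s)]
    · exact Finset.sum_congr rfl fun b hb => by rw [if_pos hb]
    · intro b _ hb
      rw [if_neg hb, map_zero]
  have := eq_zero_of_isInternal hN _ z hz hz0 a (Finset.mem_insert_self _ _)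
  simp only [z, if_true, sub_eq_zero] at this
  refine ⟨if a ∈ s then y a else 0, ?_, this⟩
  split_ifs
  exacts [hy a, zero_mem _]

end Internal

/-! ### The fine grading of the polynomial ring and of its monomial quotients -/

section Poly

variable {K : Type*} [Field K] {V : Type*}

theorem expDeg_injective : Function.Injective (expDeg : (V →₀ ℕ) → V → ℤ) := by
  intro e f h
  ext v
  exact Int.ofNat_inj.1 (congrFun h v)

@[simp] theorem expDeg_add (e f : V →₀ ℕ) : expDeg (e + f) = expDeg e + expDeg f := by
  funext v; simp [expDeg]

@[simp] theorem expDeg_zero : expDeg (0 : V →₀ ℕ) = 0 := by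
  funext v; simp [expDeg]

/-- An ideal of the polynomial ring that contains all the terms of its elements. -/
def IsMonomialIdeal (J : Ideal (MvPolynomial V K)) : Prop :=
  ∀ f ∈ J, ∀ e, coeff e f ≠ 0 → monomial e (1 : K) ∈ J

theorem monomial_mem_of_one {J : Ideal (MvPolynomial V K)} {e : V →₀ ℕ}
    (h : monomial e (1 : K) ∈ J) (c : K) : monomial e c ∈ J := by
  have : monomial e c = C c * monomial e 1 := by rw [C_mul_monomial, mul_one]
  exact this ▸ J.mul_mem_left _ h

theorem isMonomialIdeal_span (A : Set (V →₀ ℕ)) :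
    IsMonomialIdeal (Ideal.span ((fun e => monomial e (1 : K)) '' A)) := by
  classical
  intro f hf e he
  rw [mem_ideal_span_monomial_image] at hf
  rw [mem_ideal_span_monomial_image]
  intro e' he'
  rw [mem_support_iff, coeff_monomial] at he'
  split_ifs at he' with h
  · subst h
    exact hf _ (mem_support_iff.2 he)
  · exact absurd rfl he'

theorem monomial_mem_span_iff {A : Set (V →₀ ℕ)} {e : V →₀ ℕ} :
    monomial e (1 : K) ∈ Ideal.span ((fun e => monomial e (1 : K)) '' A) ↔ ∃ a ∈ A, a ≤ e := by
  classical
  rw [mem_ideal_span_monomial_image]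
  constructor
  · intro h
    exact h e (by rw [mem_support_iff, coeff_monomial, if_pos rfl]; exact one_ne_zero)
  · rintro ⟨a, ha, hae⟩ e' he'
    rw [mem_support_iff, coeff_monomial] at he'
    split_ifs at he' with h
    · exact ⟨a, ha, h ▸ hae⟩
    · exact absurd rfl he'

open Classical in
theorem isGrading_pi {ι : Type*} [Finite ι] {M : ι → Type*} [∀ i, AddCommGroup (M i)]
    [∀ i, Module (MvPolynomial V K) (M i)] {gr : ∀ i, (V → ℤ) → AddSubgroup (M i)}
    (h : ∀ i, IsGrading K (gr i)) : IsGrading K (piGrading gr) where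
  internal := by
    have := Fintype.ofFinite ι
    refine isInternal_of (fun x => ?_) fun s y hy h0 a ha => ?_
    · rw [← Finset.univ_sum_single x]
      refine sum_mem fun i _ => ?_
      obtain ⟨s, y, hy, hx⟩ := exists_sum_of_isInternal (h i).internal (x i)
      rw [← hx]
      have : (Pi.single i (∑ a ∈ s, y a) : ∀ i, M i) = ∑ a ∈ s, Pi.single i (y a) :=
        map_sum (AddMonoidHom.single M i) _ _
      rw [this]
      refine sum_mem fun a _ => AddSubgroup.mem_iSup_of_mem a fun j => ?_
      by_cases hj : j = i
      · subst hj
        rw [Pi.single_eq_same]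
        exact hy a
      · rw [Pi.single_eq_of_ne hj]
        exact zero_mem _
    · funext i
      refine eq_zero_of_isInternal (h i).internal s (fun a => y a i) (fun a => hy a i) ?_ a ha
      rw [← Finset.sum_apply, h0]
      rfl
  smul_mem a b p x hp hx i := (h i).smul_mem a b p (x i) hp (hx i)

variable [DecidableEq V]

theorem weight_single_one (e : V →₀ ℕ) :
    Finsupp.weight (fun v : V => (Pi.single v 1 : V → ℤ)) e = expDeg e := by
  funext v
  rw [Finsupp.weight_apply, Finsupp.sum, Finset.sum_apply, expDeg]
  simp only [Pi.smul_apply, Pi.single_apply, smul_ite, nsmul_eq_mul, mul_one, smul_zero]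
  rw [Finset.sum_ite_eq]
  split_ifs with h
  · rfl
  · rw [Finsupp.notMem_support_iff.1 h]; rfl

theorem mem_polyPart {a : V → ℤ} {f : MvPolynomial V K} :
    f ∈ polyPart K a ↔ ∀ e, coeff e f ≠ 0 → expDeg e = a := by
  simp only [polyPart, Submodule.mem_toAddSubgroup, mem_weightedHomogeneousSubmodule,
    IsWeightedHomogeneous, weight_single_one]

theorem monomial_mem_polyPart (e : V →₀ ℕ) (c : K) : monomial e c ∈ polyPart K (expDeg e) := by
  classical
  rw [mem_polyPart]
  intro f hf
  rw [coeff_monomial] at hf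
  split_ifs at hf with h
  · rw [h]
  · exact absurd rfl hf

theorem monomial_mem_polyPart_of_eq {e : V →₀ ℕ} {a : V → ℤ} (h : expDeg e = a) (c : K) :
    monomial e c ∈ polyPart K a :=
  h ▸ monomial_mem_polyPart e c

theorem eq_monomial_of_mem_polyPart {e : V →₀ ℕ} {f : MvPolynomial V K}
    (h : f ∈ polyPart K (expDeg e)) : f = monomial e (coeff e f) := by
  classical
  rw [mem_polyPart] at h
  ext e'
  rw [coeff_monomial]
  split_ifs with he
  · rw [he]
  · by_contra h0
    exact he (expDeg_injective (h e' h0)).symm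

theorem eq_zero_of_mem_polyPart {a : V → ℤ} {f : MvPolynomial V K} (h : f ∈ polyPart K a)
    {v : V} (hv : a v < 0) : f = 0 := by
  rw [mem_polyPart] at h
  ext e
  by_contra h0
  have := congrFun (h e h0) v
  simp only [expDeg] at this
  omega

/-- For the fine grading, a nonzero homogeneous polynomial is a term. -/
theorem exists_monomial_of_mem_polyPart {a : V → ℤ} {f : MvPolynomial V K} (h : f ∈ polyPart K a)
    (h0 : f ≠ 0) : ∃ e, expDeg e = a ∧ f = monomial e (coeff e f) := by
  obtain ⟨e, he⟩ := exists_coeff_ne_zero h0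
  have := mem_polyPart.1 h e he
  exact ⟨e, this, eq_monomial_of_mem_polyPart (this ▸ h)⟩

theorem eq_of_constantCoeff_ne_zero {a : V → ℤ} {f : MvPolynomial V K} (h : f ∈ polyPart K a)
    (h0 : constantCoeff f ≠ 0) : a = 0 := by
  rw [← mem_polyPart.1 h 0 h0, expDeg_zero]

theorem mul_mem_polyPart {a b : V → ℤ} {f g : MvPolynomial V K} (hf : f ∈ polyPart K a)
    (hg : g ∈ polyPart K b) : f * g ∈ polyPart K (a + b) :=
  IsWeightedHomogeneous.mul hf hg

theorem one_mem_polyPart : (1 : MvPolynomial V K) ∈ polyPart K 0 :=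
  monomial_mem_polyPart_of_eq expDeg_zero 1

theorem polyPart_spans (f : MvPolynomial V K) (c : V → ℤ) :
    f ∈ ⨆ a, polyPart K (a - c) := by
  rw [as_sum f]
  refine sum_mem fun e _ => ?_
  refine AddSubgroup.mem_iSup_of_mem (expDeg e + c) ?_
  exact monomial_mem_polyPart_of_eq (by rw [add_sub_cancel_right]) _

open Classical in
/-- A homogeneous component of a polynomial. -/
def polyComp (a : V → ℤ) : MvPolynomial V K →ₗ[K] MvPolynomial V K :=
  weightedHomogeneousComponent (fun v : V => (Pi.single v 1 : V → ℤ)) a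

open Classical in
theorem coeff_polyComp (a : V → ℤ) (f : MvPolynomial V K) (e : V →₀ ℕ) :
    coeff e (polyComp a f) = if expDeg e = a then coeff e f else 0 := by
  rw [polyComp, coeff_weightedHomogeneousComponent, weight_single_one]

theorem polyComp_same {a : V → ℤ} {f : MvPolynomial V K} (h : f ∈ polyPart K a) :
    polyComp a f = f := by
  ext e
  rw [coeff_polyComp]
  split_ifs with he
  · rfl
  · by_contra h0
    exact he (mem_polyPart.1 h e (Ne.symm h0))

theorem polyComp_ne {a b : V → ℤ} {f : MvPolynomial V K} (h : f ∈ polyPart K b) (hab : b ≠ a) :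
    polyComp a f = 0 := by
  ext e
  rw [coeff_polyComp]
  split_ifs with he
  · by_contra h0
    exact hab ((mem_polyPart.1 h e h0).symm.trans he)
  · rfl

/-- Monomial ideals are homogeneous for the fine grading. -/
theorem polyComp_mem {J : Ideal (MvPolynomial V K)} (hJ : IsMonomialIdeal J) {f : MvPolynomial V K}
    (hf : f ∈ J) (a : V → ℤ) : polyComp a f ∈ J := by
  rw [as_sum (polyComp a f)]
  refine sum_mem fun e he => monomial_mem_of_one (hJ f hf e ?_) _
  rw [mem_support_iff, coeff_polyComp] at he
  split_ifs at he
  · exact he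
  · exact absurd rfl he

open Classical in
theorem isGrading_polyPart (c : V → ℤ) :
    IsGrading K (M := MvPolynomial V K) (fun a => polyPart K (a - c)) where
  internal := by
    refine isInternal_of (fun f => polyPart_spans f c) fun s y hy h0 a ha => ?_
    have := congrArg (polyComp (a - c)) h0
    rw [map_sum, map_zero, Finset.sum_eq_single a] at this
    · rwa [polyComp_same (hy a)] at this
    · intro b _ hb
      exact polyComp_ne (hy b) fun h => hb (sub_left_injective h)
    · exact fun h => absurd ha h
  smul_mem a b p x hp hx := by
    rw [add_sub_assoc]
    exact mul_mem_polyPart (by convert hp) hx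

open Classical in
/-- The quotient by a monomial ideal is graded. -/
theorem isGrading_cyclic {J : Ideal (MvPolynomial V K)} (hJ : IsMonomialIdeal J) (c : V → ℤ) :
    IsGrading K (cyclicGrading J c) where
  internal := by
    refine isInternal_of (fun x => ?_) fun s y hy h0 a ha => ?_
    · obtain ⟨f, rfl⟩ := Ideal.Quotient.mk_surjective x
      have := AddSubgroup.mem_map_of_mem (Ideal.Quotient.mk J).toAddMonoidHom (polyPart_spans f c)
      rw [AddSubgroup.map_iSup] at this
      exact this
    · choose g hg hgy using hy
      have hsum : ∑ a ∈ s, g a ∈ J := by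
        rw [← Ideal.Quotient.eq_zero_iff_mem, map_sum, ← h0]
        exact Finset.sum_congr rfl fun a _ => hgy a
      have := polyComp_mem hJ hsum (a - c)
      rw [map_sum, Finset.sum_eq_single a, polyComp_same (hg a)] at this
      · rw [← hgy a]
        exact Ideal.Quotient.eq_zero_iff_mem.2 this
      · intro b _ hb
        exact polyComp_ne (hg b) fun h => hb (sub_left_injective h)
      · exact fun h => absurd ha h
  smul_mem a b p x hp hx := by
    obtain ⟨g, hg, rfl⟩ := hx
    refine ⟨p * g, ?_, ?_⟩
    · rw [add_sub_assoc]
      exact mul_mem_polyPart (by convert hp) hg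
    · exact map_mul (Ideal.Quotient.mk J) p g

/-- The law `IsGrading.smul_mem`, for any decidable equality on the set of variables. -/
theorem IsGrading.smul_mem_gr {M : Type*} [AddCommGroup M] [Module (MvPolynomial V K) M]
    {gr : (V → ℤ) → AddSubgroup M} (h : IsGrading K gr) {a b c : V → ℤ} (hc : a + b = c)
    {p : MvPolynomial V K} {x : M} (hp : p ∈ polyPart K a) (hx : x ∈ gr b) : p • x ∈ gr c :=
  hc ▸ h.smul_mem a b p x (by convert hp) hx

theorem isGrading_free {ι : Type*} [Finite ι] (deg : ι → V → ℤ) :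
    IsGrading K (freeGrading K deg) :=
  isGrading_pi fun b => isGrading_polyPart (deg b)

end Poly

/-! ### Graded free modules and the comparison theorem -/

section FreeModules

variable {K : Type*} [Field K] {V : Type*}

/-- A map from a projective module lifts along a linear map whose image contains its image. -/
theorem exists_linear_lift {R F M N : Type*} [Ring R] [AddCommGroup F] [Module R F]
    [Module.Projective R F] [AddCommGroup M] [Module R M] [AddCommGroup N] [Module R N]
    (f : M →ₗ[R] N) (g : F →ₗ[R] N) (h : ∀ x, ∃ y, f y = g x) :
    ∃ s : F →ₗ[R] M, ∀ x, f (s x) = g x := by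
  obtain ⟨s, hs⟩ := Module.projective_lifting_property f.rangeRestrict
    (g.codRestrict (LinearMap.range f) h) f.surjective_rangeRestrict
  exact ⟨s, fun x => congrArg Subtype.val (LinearMap.congr_fun hs x)⟩

theorem eq_sum_smul_single {R ι : Type*} [Semiring R] [Fintype ι] [DecidableEq ι] (x : ι → R) :
    x = ∑ b, x b • Pi.single b (1 : R) := by
  conv_lhs => rw [← Finset.univ_sum_single x]
  refine Finset.sum_congr rfl fun b _ => ?_
  rw [← Pi.single_smul, smul_eq_mul, mul_one]

open Classical in
/-- Modulo the maximal ideal, a map of free modules is given by the matrix of its constant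
coefficients. -/
theorem constantCoeff_apply {ι : Type*} [Fintype ι] {κ : Type*}
    (φ : (ι → MvPolynomial V K) →ₗ[MvPolynomial V K] (κ → MvPolynomial V K))
    (x : ι → MvPolynomial V K) (c : κ) :
    constantCoeff (φ x c) =
      ∑ b, constantCoeff (x b) * constantCoeff (φ (Pi.single b 1) c) := by
  conv_lhs => rw [eq_sum_smul_single x]
  rw [map_sum, Finset.sum_apply, map_sum]
  refine Finset.sum_congr rfl fun b _ => ?_
  rw [map_smul, Pi.smul_apply, smul_eq_mul, map_mul]

theorem constantCoeff_apply_eq_zero {ι : Type*} [Finite ι] {κ : Type*}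
    (φ : (ι → MvPolynomial V K) →ₗ[MvPolynomial V K] (κ → MvPolynomial V K))
    {x : ι → MvPolynomial V K} (hx : ∀ b, constantCoeff (x b) = 0) (c : κ) :
    constantCoeff (φ x c) = 0 := by
  have := Fintype.ofFinite ι
  rw [constantCoeff_apply]
  exact Finset.sum_eq_zero fun b _ => by rw [hx, zero_mul]

variable [DecidableEq V]

open Classical in
theorem single_mem_freeGrading {ι : Type*} (deg : ι → V → ℤ) (b : ι) {a : V → ℤ}
    {p : MvPolynomial V K} (hp : p ∈ polyPart K (a - deg b)) :
    Pi.single b p ∈ freeGrading K deg a := by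
  intro c
  by_cases hc : c = b
  · subst hc
    rwa [Pi.single_eq_same]
  · rw [Pi.single_eq_of_ne hc]
    exact zero_mem _

open Classical in
theorem single_one_mem_freeGrading {ι : Type*} (deg : ι → V → ℤ) (b : ι) :
    Pi.single b (1 : MvPolynomial V K) ∈ freeGrading K deg (deg b) :=
  single_mem_freeGrading deg b (by rw [sub_self]; exact one_mem_polyPart)

open Classical in
/-- A homogeneous map of graded free modules has unit entries only between basis elements of equal
degree. -/
theorem deg_eq_of_constantCoeff_ne_zero {ι κ : Type*} {deg : ι → V → ℤ} {deg' : κ → V → ℤ}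
    {φ : (ι → MvPolynomial V K) →ₗ[MvPolynomial V K] (κ → MvPolynomial V K)}
    (hφ : PreservesDegree (freeGrading K deg) (freeGrading K deg') φ) {b : ι} {c : κ}
    (h : constantCoeff (φ (Pi.single b 1) c) ≠ 0) : deg b = deg' c :=
  sub_eq_zero.1 (eq_of_constantCoeff_ne_zero
    (hφ _ _ (single_one_mem_freeGrading deg b) c) h)

section Free

variable {ι : Type*} [Finite ι] {deg : ι → V → ℤ} {M N : Type*} [AddCommGroup M]
  [AddCommGroup N] [Module (MvPolynomial V K) M] [Module (MvPolynomial V K) N]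
  {grM : (V → ℤ) → AddSubgroup M} {grN : (V → ℤ) → AddSubgroup N}

open Classical in
theorem preservesDegree_of_single (hM : IsGrading K grM)
    (f : (ι → MvPolynomial V K) →ₗ[MvPolynomial V K] M)
    (h : ∀ b, f (Pi.single b 1) ∈ grM (deg b)) :
    PreservesDegree (freeGrading K deg) grM f := by
  have := Fintype.ofFinite ι
  intro a x hx
  rw [eq_sum_smul_single x, map_sum]
  refine sum_mem fun b _ => ?_
  rw [map_smul]
  exact hM.smul_mem_gr (sub_add_cancel a (deg b)) (hx b) (h b)

/-- Graded free modules are projective in the category of graded modules. -/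
theorem exists_homogeneous_lift (hM : IsGrading K grM) (hN : IsGrading K grN)
    (f : M →ₗ[MvPolynomial V K] N) (hf : PreservesDegree grM grN f)
    (g : (ι → MvPolynomial V K) →ₗ[MvPolynomial V K] N)
    (hg : PreservesDegree (freeGrading K deg) grN g) (h : ∀ x, ∃ y, f y = g x) :
    ∃ s : (ι → MvPolynomial V K) →ₗ[MvPolynomial V K] M,
      PreservesDegree (freeGrading K deg) grM s ∧ ∀ x, f (s x) = g x := by
  classical
  have := Fintype.ofFinite ι
  have key : ∀ b, ∃ y ∈ grM (deg b), f y = g (Pi.single b 1) := by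
    intro b
    obtain ⟨y, hy⟩ := h (Pi.single b 1)
    have := exists_homogeneous_preimage hM.internal hN.internal f.toAddMonoidHom hf y
      (a := deg b) (by
        show f y ∈ _
        rw [hy]
        exact hg _ _ (single_one_mem_freeGrading deg b))
    obtain ⟨z, hz, hzy⟩ := this
    exact ⟨z, hz, hzy.trans hy⟩
  choose y hy hfy using key
  refine ⟨Fintype.linearCombination (MvPolynomial V K) y, ?_, fun x => ?_⟩
  · refine preservesDegree_of_single hM _ fun b => ?_
    rw [Fintype.linearCombination_apply_single, one_smul]
    exact hy b
  · refine LinearMap.congr_fun (f := f.comp (Fintype.linearCombination (MvPolynomial V K) y))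
      (g := g) ?_ x
    refine LinearMap.pi_ext' fun b => LinearMap.ext_ring ?_
    simp only [LinearMap.comp_apply, LinearMap.single_apply]
    rw [Fintype.linearCombination_apply_single, one_smul]
    exact hfy b

end Free

section Comparison

variable {M N : Type*} [AddCommGroup M]
  [AddCommGroup N] [Module (MvPolynomial V K) M] [Module (MvPolynomial V K) N]
  {grM : (V → ℤ) → AddSubgroup M} {grN : (V → ℤ) → AddSubgroup N}

/-- Comparison theorem: a homogeneous map to `N` from the degree-zero part of a complex of graded
free modules lifts to a chain map to any graded free resolution of `N`. -/
theorem exists_hom (C S : FreeComplex K V) (hN : IsGrading K grN)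
    {ε : S.X 0 →ₗ[MvPolynomial V K] N} (hS : IsResolution S grN ε)
    (α : C.X 0 →ₗ[MvPolynomial V K] N) (hα : PreservesDegree (C.gr 0) grN α)
    (h0 : ∀ x, α (C.d 0 x) = 0) : ∃ φ : FreeComplex.Hom C S, ∀ x, ε (φ.f 0 x) = α x := by
  have hfin := C.finite
  have hfinS := S.finite
  -- The homogeneous maps of the `n`-th modules which extend one step further.
  let T : ℕ → Type _ := fun n => {f : C.X n →ₗ[MvPolynomial V K] S.X n //
    PreservesDegree (C.gr n) (S.gr n) f ∧ ∀ x, ∃ y, S.d n y = f (C.d n x)}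
  have start : ∃ f : T 0, ∀ x, ε (f.1 x) = α x := by
    obtain ⟨f, hf, hfα⟩ := exists_homogeneous_lift (isGrading_free (S.deg 0)) hN ε hS.homogeneous α
      hα (fun x => hS.surjective _)
    exact ⟨⟨f, hf, fun x => (hS.exact_zero _).1 (by rw [hfα, h0])⟩, hfα⟩
  have step : ∀ n (f : T n), ∃ g : T (n + 1), ∀ x, f.1 (C.d n x) = S.d n (g.1 x) := by
    intro n f
    obtain ⟨g, hg, hgf⟩ := exists_homogeneous_lift (isGrading_free (S.deg (n + 1)))
      (isGrading_free (S.deg n)) (S.d n) (S.d_homogeneous n) (f.1.comp (C.d n))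
      (fun a x hx => f.2.1 _ _ (C.d_homogeneous n a x hx)) f.2.2
    refine ⟨⟨g, hg, fun x => (hS.exact_succ n _).1 ?_⟩, fun x => (hgf x).symm⟩
    rw [hgf, LinearMap.comp_apply, C.d_comp_d, map_zero]
  obtain ⟨f0, hf0⟩ := start
  choose next hnext using step
  let F : ∀ n, T n := fun n => Nat.rec f0 (fun n f => next n f) n
  exact ⟨⟨fun n => (F n).1, fun n => (F n).2.1, fun n x => hnext n (F n) x⟩, hf0⟩

/-- An endomorphism of a minimal resolution that lifts zero is null-homotopic, hence zero modulo
the maximal ideal. -/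
theorem constantCoeff_eq_zero_of_lift_zero {C : FreeComplex K V}
    {ε : C.X 0 →ₗ[MvPolynomial V K] M} (hC : IsResolution C grM ε) (hmin : C.IsMinimal)
    (θ : ∀ n, C.X n →ₗ[MvPolynomial V K] C.X n)
    (hθ : ∀ n x, θ n (C.d n x) = C.d n (θ (n + 1) x)) (h0 : ∀ x, ε (θ 0 x) = 0) (n : ℕ) :
    ∀ x b, constantCoeff (θ n x b) = 0 := by
  have hfin := C.finite
  -- The homotopy `s` enters into the next step only through its values on boundaries.
  suffices H : (∃ s : C.X n →ₗ[MvPolynomial V K] C.X (n + 1), ∀ x,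
      θ n (C.d n x) = C.d n (s (C.d n x))) ∧ ∀ x b, constantCoeff (θ n x b) = 0 from H.2
  induction n with
  | zero =>
    obtain ⟨s, hs⟩ := exists_linear_lift (C.d 0) (θ 0) fun x => (hC.exact_zero _).1 (h0 x)
    exact ⟨⟨s, fun x => (hs _).symm⟩, fun x b => by rw [← hs]; exact hmin _ _ _⟩
  | succ n ih =>
    obtain ⟨⟨s, hs⟩, -⟩ := ih
    obtain ⟨t, ht⟩ := exists_linear_lift (C.d (n + 1)) (θ (n + 1) - s.comp (C.d n)) fun x =>
      (hC.exact_succ n _).1 (by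
        rw [LinearMap.sub_apply, map_sub, ← hθ, LinearMap.comp_apply, hs, sub_self])
    simp only [LinearMap.sub_apply, LinearMap.comp_apply] at ht
    refine ⟨⟨t, fun x => ?_⟩, fun x b => ?_⟩
    · rw [ht, C.d_comp_d, map_zero, sub_zero]
    · have : θ (n + 1) x = C.d (n + 1) (t x) + s (C.d n x) := by rw [ht, sub_add_cancel]
      rw [this, Pi.add_apply, map_add, hmin, zero_add]
      exact constantCoeff_apply_eq_zero s (fun c => hmin n x c) b

/-- The composition of comparison maps between two minimal resolutions is the identity modulo the
maximal ideal, hence so is that of their matrices of constant coefficients, whose entries are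
nonzero only between basis elements of equal degree. -/
theorem rank_le (hM : IsGrading K grM) (R S : MinimalResolution K grM) (n : ℕ) (a : V → ℤ) :
    R.complex.rank n a ≤ S.complex.rank n a := by
  classical
  obtain ⟨φ, hφ⟩ := exists_hom R.complex S.complex hM S.isResolution R.aug
    R.isResolution.homogeneous (fun x => (R.isResolution.exact_zero _).2 ⟨x, rfl⟩)
  obtain ⟨ψ, hψ⟩ := exists_hom S.complex R.complex hM R.isResolution S.aug
    S.isResolution.homogeneous (fun x => (S.isResolution.exact_zero _).2 ⟨x, rfl⟩)
  have key := constantCoeff_eq_zero_of_lift_zero R.isResolution R.isMinimal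
    (fun n => (ψ.f n).comp (φ.f n) - LinearMap.id)
    (fun n x => by
      simp only [LinearMap.sub_apply, LinearMap.comp_apply, LinearMap.id_apply, map_sub, φ.comm,
        ψ.comm])
    (fun x => by
      simp only [LinearMap.sub_apply, LinearMap.comp_apply, LinearMap.id_apply, map_sub, hφ, hψ,
        sub_self]) n
  have hR := R.complex.finite n
  have hS := S.complex.finite n
  have hR' := Fintype.ofFinite (R.complex.ι n)
  have hS' := Fintype.ofFinite (S.complex.ι n)
  let A : Matrix {c // S.complex.deg n c = a} {b // R.complex.deg n b = a} K :=
    fun c b => constantCoeff (φ.f n (Pi.single b.1 1) c.1)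
  let B : Matrix {b // R.complex.deg n b = a} {c // S.complex.deg n c = a} K :=
    fun b c => constantCoeff (ψ.f n (Pi.single c.1 1) b.1)
  have hBA : B * A = 1 := by
    ext b b'
    have h := key (Pi.single b'.1 1) b.1
    simp only [LinearMap.sub_apply, LinearMap.comp_apply, LinearMap.id_apply, Pi.sub_apply,
      map_sub, sub_eq_zero] at h
    rw [constantCoeff_apply] at h
    rw [Matrix.mul_apply, Matrix.one_apply]
    have h1 : constantCoeff ((Pi.single b'.1 1 : R.complex.ι n → MvPolynomial V K) b.1)
        = if b = b' then (1 : K) else 0 := by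
      rw [Pi.single_apply]
      by_cases hb : b = b'
      · rw [if_pos hb, if_pos (congrArg Subtype.val hb), map_one]
      · rw [if_neg hb, if_neg (fun h => hb (Subtype.ext h)), map_zero]
    rw [← h1, ← h]
    rw [← Finset.sum_subset (Finset.filter_subset (fun c => S.complex.deg n c = a) Finset.univ)]
    · rw [Finset.sum_subtype (p := fun c => S.complex.deg n c = a) _ (by simp)]
      exact Finset.sum_congr rfl fun c _ => mul_comm _ _
    · intro c _ hc
      by_contra h0
      refine hc (Finset.mem_filter.2 ⟨Finset.mem_univ _, ?_⟩)
      rw [← deg_eq_of_constantCoeff_ne_zero (φ.f_homogeneous n) (left_ne_zero_of_mul h0), b'.2]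
  have h1 := Matrix.rank_mul_le_right B A
  rw [hBA, Matrix.rank_one] at h1
  have := h1.trans (Matrix.rank_le_card_height A)
  rwa [FreeComplex.rank, FreeComplex.rank, Nat.card_eq_fintype_card, Nat.card_eq_fintype_card]

/-- The multigraded Betti numbers are computed by every minimal graded free resolution. -/
theorem rank_eq_betti (hM : IsGrading K grM) (R : MinimalResolution K grM) (n : ℕ) (a : V → ℤ) :
    R.complex.rank n a = betti K grM n a := by
  have h : Nonempty (MinimalResolution K grM) := ⟨R⟩
  rw [betti, dif_pos h]
  exact le_antisymm (rank_le hM _ _ n a) (rank_le hM _ _ n a)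

end Comparison

end FreeModules

/-! ### Existence of minimal graded free resolutions -/

section Existence

variable {K : Type*} [Field K] {V : Type*}
  {M : Type*} [AddCommGroup M] [Module (MvPolynomial V K) M] {grM : (V → ℤ) → AddSubgroup M}

/-- A submodule generated by homogeneous elements. -/
def IsHomogeneousSubmodule (grM : (V → ℤ) → AddSubgroup M) (N : Submodule (MvPolynomial V K) M) :
    Prop :=
  Submodule.span (MvPolynomial V K) {x | x ∈ N ∧ ∃ a, x ∈ grM a} = N

theorem IsGrading.exists_sum (hM : IsGrading K grM) (x : M) :
    ∃ (s : Finset (V → ℤ)) (y : (V → ℤ) → M), (∀ a, y a ∈ grM a) ∧ ∑ a ∈ s, y a = x := by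
  classical
  exact exists_sum_of_isInternal hM.internal x

theorem isHomogeneousSubmodule_top (hM : IsGrading K grM) :
    IsHomogeneousSubmodule grM (⊤ : Submodule (MvPolynomial V K) M) := by
  refine top_unique fun x _ => ?_
  obtain ⟨s, y, hy, rfl⟩ := hM.exists_sum x
  exact sum_mem fun a _ => Submodule.subset_span ⟨trivial, a, hy a⟩

theorem mem_iSup_ker {N : Type*} [AddCommGroup N] [Module (MvPolynomial V K) N]
    {grN : (V → ℤ) → AddSubgroup N} (hM : IsGrading K grM) (hN : IsGrading K grN)
    (f : M →ₗ[MvPolynomial V K] N) (hf : PreservesDegree grM grN f) {x : M} (hx : f x = 0) :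
    x ∈ ⨆ a, grM a ⊓ f.toAddMonoidHom.ker := by
  classical
  exact mem_iSup_ker_of_isInternal hM.internal hN.internal f.toAddMonoidHom hf hx

theorem isHomogeneousSubmodule_ker {N : Type*} [AddCommGroup N] [Module (MvPolynomial V K) N]
    {grN : (V → ℤ) → AddSubgroup N} (hM : IsGrading K grM) (hN : IsGrading K grN)
    (f : M →ₗ[MvPolynomial V K] N) (hf : PreservesDegree grM grN f) :
    IsHomogeneousSubmodule grM (LinearMap.ker f) := by
  refine le_antisymm (Submodule.span_le.2 fun x hx => hx.1) fun x hx => ?_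
  have h : (⨆ a, grM a ⊓ f.toAddMonoidHom.ker) ≤ (Submodule.span (MvPolynomial V K)
      {x | x ∈ LinearMap.ker f ∧ ∃ a, x ∈ grM a}).toAddSubgroup :=
    iSup_le fun a y hy => Submodule.subset_span ⟨hy.2, a, hy.1⟩
  exact h (mem_iSup_ker hM hN f hf hx)

variable [DecidableEq V]

/-- A finitely generated graded submodule has a graded free cover whose kernel lies in the maximal
ideal times the cover: the relations between homogeneous generators have coefficients in the
maximal ideal if no generator can be omitted: by homogeneity, a relation with a nonzero constant
coefficient expresses one of the generators by the others. -/
theorem exists_minimal_cover (hM : IsGrading K grM) (N : Submodule (MvPolynomial V K) M)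
    (hfg : N.FG) (hN : IsHomogeneousSubmodule grM N) :
    ∃ (n : ℕ) (deg : Fin n → V → ℤ) (f : (Fin n → MvPolynomial V K) →ₗ[MvPolynomial V K] M),
      PreservesDegree (freeGrading K deg) grM f ∧ LinearMap.range f = N ∧
        ∀ x, f x = 0 → ∀ b, constantCoeff (x b) = 0 := by
  classical
  have hex : ∃ n, ∃ g : Fin n → M, (∀ b, ∃ a, g b ∈ grM a) ∧
      Submodule.span (MvPolynomial V K) (Set.range g) = N := by
    obtain ⟨t, ht, htN⟩ := (Submodule.fg_span_iff_fg_span_finset_subset _).1 (hN.symm ▸ hfg)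
    refine ⟨t.card, fun i => (t.equivFin.symm i).1, fun b => (ht (t.equivFin.symm b).2).2, ?_⟩
    rw [hN] at htN
    rw [htN]
    congr 1
    ext x
    constructor
    · rintro ⟨i, rfl⟩
      exact (t.equivFin.symm i).2
    · intro hx
      exact ⟨t.equivFin ⟨x, hx⟩, by simp⟩
  obtain ⟨g, hg, hspan⟩ := Nat.find_spec hex
  have hmin := fun k => Nat.find_min hex (m := k)
  generalize Nat.find hex = n at g hmin
  choose deg hdeg using hg
  have hpres : PreservesDegree (freeGrading K deg) grM
      (Fintype.linearCombination (MvPolynomial V K) g) := by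
    refine preservesDegree_of_single hM _ fun b => ?_
    rw [Fintype.linearCombination_apply_single, one_smul]
    exact hdeg b
  refine ⟨n, deg, Fintype.linearCombination (MvPolynomial V K) g, hpres, ?_, fun x hx b => ?_⟩
  · rw [Fintype.range_linearCombination, hspan]
  have h := mem_iSup_ker (isGrading_free deg) hM _ hpres hx
  refine (iSup_le (a := ((constantCoeff : MvPolynomial V K →+* K).toAddMonoidHom.comp
    (Pi.evalAddMonoidHom (fun _ : Fin n => MvPolynomial V K) b)).ker) fun a z hz => ?_) h
  rw [AddMonoidHom.mem_ker]
  by_contra hne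
  replace hne : constantCoeff (z b) ≠ 0 := hne
  have hzb : z b = C (constantCoeff (z b)) := by
    have h1 : z b ∈ polyPart K (a - deg b) := hz.1 b
    have h0 := eq_of_constantCoeff_ne_zero h1 hne
    rw [h0, ← expDeg_zero] at h1
    exact eq_monomial_of_mem_polyPart h1
  obtain _ | n := n
  · exact b.elim0
  have hrel : z b • g b + ∑ i, z (b.succAbove i) • g (b.succAbove i) = 0 := by
    have : Fintype.linearCombination (MvPolynomial V K) g z = 0 := hz.2
    rw [Fintype.linearCombination_apply,
      Fin.sum_univ_succAbove _ b] at this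
    exact this
  have hgb : g b ∈ Submodule.span (MvPolynomial V K) (Set.range (g ∘ b.succAbove)) := by
    have h1 : g b = (C (constantCoeff (z b))⁻¹ : MvPolynomial V K) • (z b • g b) := by
      generalize constantCoeff (z b) = c at hzb hne
      rw [hzb, smul_smul, ← C_mul, inv_mul_cancel₀ hne, C_1, one_smul]
    rw [h1, eq_neg_of_add_eq_zero_left hrel]
    exact Submodule.smul_mem _ _ (neg_mem (sum_mem fun i _ =>
      Submodule.smul_mem _ _ (Submodule.subset_span ⟨i, rfl⟩)))
  refine hmin n (Nat.lt_succ_self n) ⟨g ∘ b.succAbove, fun i => ⟨_, hdeg _⟩, ?_⟩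
  rw [← hspan]
  refine le_antisymm (Submodule.span_mono (Set.range_comp_subset_range _ _))
    (Submodule.span_le.2 ?_)
  rintro _ ⟨i, rfl⟩
  obtain rfl | ⟨j, rfl⟩ := Fin.eq_self_or_eq_succAbove b i
  · exact hgb
  · exact Submodule.subset_span ⟨j, rfl⟩

variable (K V) in
/-- A graded submodule, contained in the maximal ideal times the ambient module, of a graded free
module of finite rank: a syzygy module that occurs in a minimal free resolution. -/
structure Syzygy where
  n : ℕ
  deg : Fin n → V → ℤ
  Z : Submodule (MvPolynomial V K) (Fin n → MvPolynomial V K)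
  homogeneous : IsHomogeneousSubmodule (freeGrading K deg) Z
  minimal : ∀ x ∈ Z, ∀ b, constantCoeff (x b) = 0

/-- A minimal cover of a syzygy module; its kernel is the next syzygy module. -/
theorem Syzygy.exists_next [Finite V] (s : Syzygy K V) :
    ∃ (t : Syzygy K V) (f : (Fin t.n → MvPolynomial V K) →ₗ[MvPolynomial V K]
        (Fin s.n → MvPolynomial V K)),
      PreservesDegree (freeGrading K t.deg) (freeGrading K s.deg) f ∧ LinearMap.range f = s.Z ∧
        LinearMap.ker f = t.Z := by
  obtain ⟨n, deg, f, hf, hr, hk⟩ := exists_minimal_cover (isGrading_free s.deg) s.Z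
    (IsNoetherian.noetherian _) s.homogeneous
  exact ⟨⟨n, deg, LinearMap.ker f, isHomogeneousSubmodule_ker (isGrading_free deg)
    (isGrading_free s.deg) f hf, hk⟩, f, hf, hr, rfl⟩

/-- Every finitely generated graded module has a minimal graded free resolution. -/
theorem exists_minimalResolution [Finite V] [Module.Finite (MvPolynomial V K) M]
    (hM : IsGrading K grM) : Nonempty (MinimalResolution K grM) := by
  obtain ⟨n, deg, ε, hε, hr, hk⟩ := exists_minimal_cover hM ⊤ Module.Finite.fg_top
    (isHomogeneousSubmodule_top hM)
  choose next f hf hrange hker using fun s : Syzygy K V => s.exists_next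
  let s₀ : Syzygy K V := ⟨n, deg, LinearMap.ker ε,
    isHomogeneousSubmodule_ker (isGrading_free deg) hM ε hε, hk⟩
  let S : ℕ → Syzygy K V := fun n => Nat.rec s₀ (fun _ s => next s) n
  let C : FreeComplex K V :=
    { ι := fun n => Fin (S n).n
      finite := fun n => inferInstance
      deg := fun n => (S n).deg
      d := fun n => f (S n)
      d_homogeneous := fun n => hf (S n)
      d_comp_d := fun n x => by
        have : f (S (n + 1)) x ∈ (S (n + 1)).Z := hrange (S (n + 1)) ▸ ⟨x, rfl⟩
        exact (hker (S n)).symm.le this }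
  refine ⟨⟨C, ε, ⟨hε, LinearMap.range_eq_top.1 hr, ?_, fun n => ?_⟩, fun n x b => ?_⟩⟩
  · exact LinearMap.exact_iff.2 (hrange s₀).symm
  · exact LinearMap.exact_iff.2 ((hker (S n)).trans (hrange (S (n + 1))).symm)
  · exact (S n).minimal _ (hrange (S n) ▸ ⟨x, rfl⟩) b

end Existence

theorem mem_freeGrading {K : Type*} [Field K] {V : Type*} [DecidableEq V] {ι : Type*}
    {deg : ι → V → ℤ} {a : V → ℤ} {x : ι → MvPolynomial V K} :
    x ∈ freeGrading K deg a ↔ ∀ b, x b ∈ polyPart K (a - deg b) := Iff.rfl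

/-! ### Direct sums of resolutions -/

section DirectSum

variable {K : Type*} [Field K] {V : Type*} [DecidableEq V] {U : Type}

namespace FreeComplex

/-- The direct sum of the shifted complexes `C u (-τ u)`. -/
def directSum [Finite U] (C : U → FreeComplex K V) (τ : U → V → ℤ) : FreeComplex K V where
  ι n := Σ u, (C u).ι n
  finite n := by
    have := fun u => (C u).finite n
    infer_instance
  deg n b := (C b.1).deg n b.2 + τ b.1
  d n := LinearMap.pi fun b : (Σ u, (C u).ι n) =>
    (LinearMap.proj b.2).comp (((C b.1).d n).comp
      (LinearMap.funLeft _ _ (Sigma.mk (β := fun u => (C u).ι (n + 1)) b.1)))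
  d_homogeneous n a x hx b := by
    have h := (C b.1).d_homogeneous n (a - τ b.1) (fun c => x ⟨b.1, c⟩)
      (fun c => by
        have := mem_freeGrading.1 hx ⟨b.1, c⟩
        show _ ∈ polyPart K (a - τ b.1 - _)
        rw [sub_right_comm, sub_sub]
        exact this) b.2
    show _ ∈ polyPart K (a - (_ + _))
    rw [← sub_sub, sub_right_comm]
    exact h
  d_comp_d n x := by
    funext b
    exact congrFun ((C b.1).d_comp_d n (fun c => x ⟨b.1, c⟩)) b.2

theorem rank_directSum [Fintype U] (C : U → FreeComplex K V) (τ : U → V → ℤ) (n : ℕ) (a : V → ℤ) :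
    (directSum C τ).rank n a = ∑ u, (C u).rank n (a - τ u) := by
  have := fun u => (C u).finite n
  simp only [rank]
  rw [← Nat.card_sigma]
  exact Nat.card_congr
    { toFun := fun b => ⟨b.1.1, b.1.2, eq_sub_of_add_eq b.2⟩
      invFun := fun b => ⟨⟨b.1, b.2.1⟩, add_eq_of_eq_sub b.2.2⟩
      left_inv := fun _ => rfl
      right_inv := fun _ => rfl }

end FreeComplex

/-- The direct sum of minimal resolutions is a minimal resolution of the direct sum. -/
def MinimalResolution.directSum [Finite U] {M : U → Type*} [∀ u, AddCommGroup (M u)]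
    [∀ u, Module (MvPolynomial V K) (M u)] {gr : ∀ u, (V → ℤ) → AddSubgroup (M u)}
    (R : ∀ u, MinimalResolution K (gr u)) (τ : U → V → ℤ) :
    MinimalResolution K (piGrading fun u a => gr u (a - τ u)) where
  complex := FreeComplex.directSum (fun u => (R u).complex) τ
  aug := LinearMap.pi fun u => (R u).aug.comp
    (LinearMap.funLeft _ _ (Sigma.mk (β := fun u => (R u).complex.ι 0) u))
  isResolution :=
    { homogeneous := fun a x hx u => by
        refine (R u).isResolution.homogeneous (a - τ u) (fun c => x ⟨u, c⟩) fun c => ?_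
        have := mem_freeGrading.1 hx ⟨u, c⟩
        show _ ∈ polyPart K (a - τ u - _)
        rw [sub_right_comm, sub_sub]
        exact this
      surjective := fun y => by
        choose x hx using fun u => (R u).isResolution.surjective (y u)
        exact ⟨fun b => x b.1 b.2, funext hx⟩
      exact_zero := fun x => by
        constructor
        · intro h
          choose y hy using fun u => ((R u).isResolution.exact_zero _).1 (congrFun h u)
          exact ⟨fun b => y b.1 b.2, funext fun b => congrFun (hy b.1) b.2⟩
        · rintro ⟨y, rfl⟩
          funext u
          exact ((R u).isResolution.exact_zero _).2 ⟨fun c => y ⟨u, c⟩, rfl⟩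
      exact_succ := fun n x => by
        constructor
        · intro h
          choose y hy using fun u => ((R u).isResolution.exact_succ n (fun c => x ⟨u, c⟩)).1
            (funext fun c => congrFun h ⟨u, c⟩)
          exact ⟨fun b => y b.1 b.2, funext fun b => congrFun (hy b.1) b.2⟩
        · rintro ⟨y, rfl⟩
          exact FreeComplex.d_comp_d _ _ _ }
  isMinimal n x b := (R b.1).isMinimal n (fun c => x ⟨b.1, c⟩) b.2

end DirectSum

/-! ### Resolutions over which a variable is regular -/

section Degrees

variable {K : Type*} [Field K] {V : Type*} [DecidableEq V]

/-- An element of positive degree in `v` of a free module whose basis has degree zero in `v` is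
divisible by `X v`. -/
theorem exists_X_smul_eq {ι : Type*} {deg : ι → V → ℤ} {v : V} (hdeg : ∀ b, deg b v = 0)
    {a : V → ℤ} (ha : 0 < a v) {x : ι → MvPolynomial V K} (hx : x ∈ freeGrading K deg a) :
    ∃ y : ι → MvPolynomial V K, (X v : MvPolynomial V K) • y = x := by
  have : ∀ b, ∃ p : MvPolynomial V K, X v * p = x b := by
    intro b
    have h := mem_freeGrading.1 hx b
    by_cases h0 : x b = 0
    · exact ⟨0, by rw [h0, mul_zero]⟩
    obtain ⟨e, he, hxe⟩ := exists_monomial_of_mem_polyPart h h0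
    have h1 : Finsupp.single v 1 ≤ e := by
      rw [Finsupp.single_le_iff]
      have := congrFun he v
      simp only [expDeg, Pi.sub_apply, hdeg] at this
      omega
    refine ⟨monomial (e - Finsupp.single v 1) (coeff e (x b)), ?_⟩
    rw [X, monomial_mul, one_mul, add_tsub_cancel_of_le h1, ← hxe]
  choose y hy using this
  exact ⟨y, funext hy⟩

theorem eq_zero_of_mem_freeGrading {ι : Type*} {deg : ι → V → ℤ} {v : V} (hdeg : ∀ b, deg b v = 0)
    {a : V → ℤ} (ha : a v < 0) {x : ι → MvPolynomial V K} (hx : x ∈ freeGrading K deg a) :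
    x = 0 := by
  funext b
  refine eq_zero_of_mem_polyPart (mem_freeGrading.1 hx b) (v := v) ?_
  rw [Pi.sub_apply, hdeg, sub_zero]
  exact ha

variable {M : Type*} [AddCommGroup M] [Module (MvPolynomial V K) M]
  {grM : (V → ℤ) → AddSubgroup M}

/-- The basis of a minimal cover of the image of `f` has degree zero in `v` if all homogeneous
elements of that image of positive degree in `v` are multiples of `X v`, and none has negative
degree. -/
theorem deg_apply_eq_zero {ι : Type*} {deg : ι → V → ℤ} {v : V}
    (f : (ι → MvPolynomial V K) →ₗ[MvPolynomial V K] M)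
    (hf : PreservesDegree (freeGrading K deg) grM f)
    (hmin : ∀ x, f x = 0 → ∀ b, constantCoeff (x b) = 0)
    (hpos : ∀ a x, f x ∈ grM a → 0 < a v → ∃ y, (X v : MvPolynomial V K) • f y = f x)
    (hneg : ∀ a x, x ∈ grM a → a v < 0 → x = 0) (b : ι) : deg b v = 0 := by
  classical
  have hb := hf _ _ (single_one_mem_freeGrading (K := K) deg b)
  rcases lt_trichotomy (deg b v) 0 with h | h | h
  · have := hmin _ (hneg _ _ hb h) b
    rw [Pi.single_eq_same, map_one] at this
    exact absurd this one_ne_zero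
  · exact h
  · obtain ⟨y, hy⟩ := hpos _ _ hb h
    have := hmin (Pi.single b 1 - (X v : MvPolynomial V K) • y)
      (by rw [map_sub, map_smul, hy, sub_self]) b
    rw [Pi.sub_apply, Pi.single_eq_same, Pi.smul_apply, smul_eq_mul, map_sub, map_mul, map_one,
      constantCoeff_X, zero_mul, sub_zero] at this
    exact absurd this one_ne_zero

/-- If the variable `X v` is regular on `M` and `M` is generated in degree zero with respect to `v`,
then the resolution of `M` is extended from the ring without `X v`: the degrees of all basis
elements have `v`-component zero. -/
theorem MinimalResolution.deg_apply_eq_zero (R : MinimalResolution K grM) {v : V}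
    (hpos : ∀ a x, x ∈ grM a → 0 < a v → ∃ y, (X v : MvPolynomial V K) • y = x)
    (hneg : ∀ a x, x ∈ grM a → a v < 0 → x = 0)
    (hreg : ∀ x : M, (X v : MvPolynomial V K) • x = 0 → x = 0) (n : ℕ) (b : R.complex.ι n) :
    R.complex.deg n b v = 0 := by
  have hker : ∀ n x, R.complex.d n x = 0 → ∀ b, constantCoeff (x b) = 0 := by
    intro n x hx b
    obtain ⟨y, rfl⟩ := (R.isResolution.exact_succ n x).1 hx
    exact R.isMinimal _ _ _
  have h0 : ∀ b, R.complex.deg 0 b v = 0 := by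
    refine Multigraded.deg_apply_eq_zero R.aug R.isResolution.homogeneous (fun x hx b => ?_)
      (fun a x hx ha => ?_) hneg
    · obtain ⟨y, rfl⟩ := (R.isResolution.exact_zero x).1 hx
      exact R.isMinimal _ _ _
    · obtain ⟨y, hy⟩ := hpos a _ hx ha
      obtain ⟨z, rfl⟩ := R.isResolution.surjective y
      exact ⟨z, hy⟩
  have h1 : ∀ b, R.complex.deg 1 b v = 0 := by
    refine Multigraded.deg_apply_eq_zero (R.complex.d 0) (R.complex.d_homogeneous 0) (hker 0)
      (fun a x hx ha => ?_) (fun a x hx ha => eq_zero_of_mem_freeGrading h0 ha hx)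
    obtain ⟨y, hy⟩ := exists_X_smul_eq h0 ha hx
    have hy0 : R.aug y = 0 := hreg _ (by
      rw [← map_smul, hy]
      exact (R.isResolution.exact_zero _).2 ⟨x, rfl⟩)
    obtain ⟨z, rfl⟩ := (R.isResolution.exact_zero y).1 hy0
    exact ⟨z, hy⟩
  suffices H : (∀ b, R.complex.deg n b v = 0) ∧ ∀ b, R.complex.deg (n + 1) b v = 0 from H.1 b
  clear b
  induction n with
  | zero => exact ⟨h0, h1⟩
  | succ n ih =>
    refine ⟨ih.2, Multigraded.deg_apply_eq_zero (R.complex.d (n + 1))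
      (R.complex.d_homogeneous (n + 1)) (hker (n + 1)) (fun a x hx ha => ?_)
      (fun a x hx ha => eq_zero_of_mem_freeGrading ih.2 ha hx)⟩
    obtain ⟨y, hy⟩ := exists_X_smul_eq ih.2 ha hx
    have hy0 : R.complex.d n y = 0 := by
      have : (X v : MvPolynomial V K) • R.complex.d n y = 0 := by
        rw [← map_smul, hy, R.complex.d_comp_d]
      exact (smul_eq_zero.1 this).resolve_left (X_ne_zero v)
    obtain ⟨z, rfl⟩ := (R.isResolution.exact_succ n y).1 hy0
    exact ⟨z, hy⟩

end Degrees

/-! ### Mapping cones -/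

section Cone

variable {K : Type*} [Field K] {V : Type*} [DecidableEq V]

namespace FreeComplex

variable {C D : FreeComplex K V} (φ : Hom C D)

theorem cone_d_zero (x : (cone φ).X 1) :
    (cone φ).d 0 x = D.d 0 (fun b => x (Sum.inl b)) + φ.f 0 (fun b => x (Sum.inr b)) := rfl

theorem cone_d_succ (n : ℕ) (x : (cone φ).X (n + 2)) :
    (cone φ).d (n + 1) x = Sum.elim
      (D.d (n + 1) (fun b => x (Sum.inl b)) + φ.f (n + 1) (fun b => x (Sum.inr b)))
      (-C.d n (fun b => x (Sum.inr b))) := by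
  funext b
  rcases b with b | b <;> rfl

theorem rank_cone_zero (a : V → ℤ) : (cone φ).rank 0 a = D.rank 0 a := rfl

theorem rank_cone_succ (n : ℕ) (a : V → ℤ) :
    (cone φ).rank (n + 1) a = D.rank (n + 1) a + C.rank n a := by
  have := C.finite
  have := D.finite
  simp only [rank]
  rw [← Nat.card_sum]
  exact Nat.card_congr (Equiv.subtypeSum (p := fun b : D.ι (n + 1) ⊕ C.ι n =>
    Sum.elim (D.deg (n + 1)) (C.deg n) b = a))

/-- The mapping cone is minimal if no basis element of the source has the same degree as a basis
element of the target in the same homological degree. -/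
theorem cone_isMinimal (hC : C.IsMinimal) (hD : D.IsMinimal)
    (hdeg : ∀ n (c : C.ι n) (b : D.ι n), C.deg n c ≠ D.deg n b) : (cone φ).IsMinimal := by
  classical
  have hφ : ∀ n x b, constantCoeff (φ.f n x b) = 0 := by
    intro n x b
    have := C.finite n
    have := Fintype.ofFinite (C.ι n)
    rw [constantCoeff_apply]
    refine Finset.sum_eq_zero fun c _ => ?_
    by_contra h
    exact hdeg n c b (deg_eq_of_constantCoeff_ne_zero (φ.f_homogeneous n) (right_ne_zero_of_mul h))
  intro n x b
  cases n with
  | zero =>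
    rw [cone_d_zero]
    exact (map_add constantCoeff _ _).trans
      ((congrArg₂ (· + ·) (hD 0 _ b) (hφ 0 _ b)).trans (add_zero 0))
  | succ n =>
    rw [cone_d_succ]
    rcases b with b | b
    · rw [Sum.elim_inl, Pi.add_apply, map_add, hD, hφ, add_zero]
    · rw [Sum.elim_inr, Pi.neg_apply, map_neg, hC, neg_zero]

section Exact

variable {M N : Type*} [AddCommGroup M] [AddCommGroup N] [Module (MvPolynomial V K) M]
  [Module (MvPolynomial V K) N] {grN : (V → ℤ) → AddSubgroup N}
  {ε : C.X 0 →ₗ[MvPolynomial V K] M} {η : D.X 0 →ₗ[MvPolynomial V K] N}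
  (δ : M →ₗ[MvPolynomial V K] N)

/-- The cokernel of the cone is that of `δ`. -/
theorem range_cone_d_zero (hD : IsResolution D grN η) (hε : Function.Surjective ε)
    (hφ : ∀ x, η (φ.f 0 x) = δ (ε x)) (x : D.X 0) :
    (∃ y, (cone φ).d 0 y = x) ↔ ∃ g, δ g = η x := by
  constructor
  · rintro ⟨y, rfl⟩
    refine ⟨ε fun b => y (Sum.inr b), ?_⟩
    rw [cone_d_zero, ← hφ]
    refine ((map_add η _ _).trans ?_).symm
    rw [(hD.exact_zero _).2 ⟨_, rfl⟩, zero_add]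
  · rintro ⟨g, hg⟩
    obtain ⟨z, rfl⟩ := hε g
    obtain ⟨y, hy⟩ := (hD.exact_zero (x - φ.f 0 z)).1 (by rw [map_sub, hφ, hg, sub_self])
    exact ⟨Sum.elim y z, (congrArg (· + φ.f 0 z) hy).trans (sub_add_cancel _ _)⟩

/-- The cone is acyclic in positive degrees if `C` resolves the image of `δ`. -/
theorem cone_exact_succ (hD : IsResolution D grN η) (hφ : ∀ x, η (φ.f 0 x) = δ (ε x))
    (hC0 : ∀ x, δ (ε x) = 0 → ∃ y, C.d 0 y = x)
    (hC : ∀ n, Function.Exact (C.d (n + 1)) (C.d n)) (n : ℕ) :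
    Function.Exact ((cone φ).d (n + 1)) ((cone φ).d n) := by
  have key : ∀ n (y : D.X (n + 1)) (z : C.X n), D.d n y + φ.f n z = 0 →
      (∃ w, C.d n w = z) → ∃ (y' : D.X (n + 2)) (w : C.X (n + 1)),
        D.d (n + 1) y' + φ.f (n + 1) w = y ∧ -C.d n w = z := by
    rintro n y z h ⟨w, rfl⟩
    obtain ⟨y', hy'⟩ := (hD.exact_succ n (y + φ.f (n + 1) w)).1 (by rw [map_add, ← φ.comm, h])
    exact ⟨y', -w, by rw [hy', map_neg, add_neg_cancel_right], by rw [map_neg, neg_neg]⟩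
  intro x
  constructor
  · intro hx
    have : (∃ w, C.d n w = fun b => x (Sum.inr b)) ∧
        D.d n (fun b => x (Sum.inl b)) + φ.f n (fun b => x (Sum.inr b)) = 0 := by
      cases n with
      | zero =>
        refine ⟨hC0 _ ?_, hx⟩
        have h1 : η (D.d 0 fun b => x (Sum.inl b)) = 0 := (hD.exact_zero _).2 ⟨_, rfl⟩
        have h2 :=
          (map_add η (D.d 0 fun b => x (Sum.inl b)) (φ.f 0 fun b => x (Sum.inr b))).symm.trans
            ((congrArg η hx).trans (map_zero η))
        rwa [h1, zero_add, hφ] at h2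
      | succ n =>
        rw [cone_d_succ] at hx
        exact ⟨(hC n _).1 (neg_eq_zero.1 (funext fun b => congrFun hx (Sum.inr b))),
          funext fun b => congrFun hx (Sum.inl b)⟩
    obtain ⟨y', w, h1, h2⟩ := key n _ _ this.2 this.1
    refine ⟨Sum.elim y' w, (cone_d_succ φ n (Sum.elim y' w)).trans ?_⟩
    funext b
    rcases b with b | b
    · exact congrFun h1 b
    · exact congrFun h2 b
  · rintro ⟨y, rfl⟩
    exact (cone φ).d_comp_d n y

end Exact

end FreeComplex

end Cone

/-! ### Iterated mapping cones -/

section IteratedCone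

variable {K : Type*} [Field K] {V : Type*} [DecidableEq V] {G : ℕ → Type*}
  [∀ k, AddCommGroup (G k)] [∀ k, Module (MvPolynomial V K) (G k)]
  {gr : ∀ k, (V → ℤ) → AddSubgroup (G k)} {δ : ∀ k, G (k + 1) →ₗ[MvPolynomial V K] G k}
  {R : ∀ k, MinimalResolution K (gr k)} {d : ℕ}

/-- An iterated mapping cone resolves the cokernel of the next map of the sequence. -/
theorem IteratedCone.resolves (hδ : ∀ k, Function.Exact (δ (k + 1)) (δ k))
    (hd : ∀ k, d < k → Subsingleton (G k)) {k : ℕ} {C : FreeComplex K V}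
    {ε : C.X 0 →ₗ[MvPolynomial V K] G k} (h : IteratedCone δ R d k C ε) :
    PreservesDegree (C.gr 0) (gr k) ε ∧ Function.Surjective ε ∧
      (∀ n, Function.Exact (C.d (n + 1)) (C.d n)) ∧
      ∀ x, (∃ y, C.d 0 y = x) ↔ ∃ g, δ k g = ε x := by
  induction h with
  | base =>
    have hR := (R d).isResolution
    refine ⟨hR.homogeneous, hR.surjective, hR.exact_succ, fun x => ?_⟩
    have := hd (d + 1) (Nat.lt_succ_self d)
    refine ((hR.exact_zero x).symm.trans ⟨fun h => ⟨0, by rw [map_zero, h]⟩, ?_⟩)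
    rintro ⟨g, hg⟩
    rw [← hg, Subsingleton.elim g 0, map_zero]
  | @step k C ε h φ hφ ih =>
    obtain ⟨-, h1, h2, h3⟩ := ih
    have hR := (R k).isResolution
    exact ⟨hR.homogeneous, hR.surjective,
      FreeComplex.cone_exact_succ φ (δ k) hR hφ (fun x hx => (h3 x).2 ((hδ k _).1 hx)) h2,
      FreeComplex.range_cone_d_zero φ (δ k) hR h1 hφ⟩

/-- The lifts that are needed for the iterated mapping cones exist. -/
theorem exists_iteratedCone (hgr : ∀ k, IsGrading K (gr k))
    (hpres : ∀ k, PreservesDegree (gr (k + 1)) (gr k) (δ k))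
    (hδ : ∀ k, Function.Exact (δ (k + 1)) (δ k))
    (hd : ∀ k, d < k → Subsingleton (G k)) {k : ℕ} (hk : k ≤ d) :
    ∃ (C : FreeComplex K V) (ε : C.X 0 →ₗ[MvPolynomial V K] G k), IteratedCone δ R d k C ε := by
  induction hk using Nat.decreasingInduction with
  | self => exact ⟨_, _, .base⟩
  | of_succ k hk ih =>
    obtain ⟨C, ε, h⟩ := ih
    obtain ⟨h0, -, -, h3⟩ := h.resolves hδ hd
    obtain ⟨φ, hφ⟩ := exists_hom C (R k).complex (hgr k) (R k).isResolution ((δ k).comp ε)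
      (fun a x hx => hpres k _ _ (h0 a x hx))
      (fun x => (hδ k _).2 ((h3 _).1 ⟨x, rfl⟩))
    exact ⟨_, _, .step h φ hφ⟩

theorem IteratedCone.le {k : ℕ} {C : FreeComplex K V} {ε : C.X 0 →ₗ[MvPolynomial V K] G k}
    (h : IteratedCone δ R d k C ε) : k ≤ d := by
  induction h with
  | base => exact le_rfl
  | step _ _ _ ih => exact (Nat.le_succ _).trans ih

/-- An iterated mapping cone is minimal if some additive function of the degree separates the
resolutions of the different modules of the sequence. -/
theorem IteratedCone.isMinimal (w : (V → ℤ) → ℤ)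
    (hw : ∀ k n (b : (R k).complex.ι n), w ((R k).complex.deg n b) = k) {k : ℕ}
    {C : FreeComplex K V} {ε : C.X 0 →ₗ[MvPolynomial V K] G k} (h : IteratedCone δ R d k C ε) :
    C.IsMinimal ∧ ∀ n (b : C.ι n), (k : ℤ) ≤ w (C.deg n b) := by
  induction h with
  | base => exact ⟨(R d).isMinimal, fun n b => (hw d n b).ge⟩
  | @step k C ε h φ hφ ih =>
    refine ⟨FreeComplex.cone_isMinimal φ ih.1 (R k).isMinimal fun n c b hcb => ?_, fun n b => ?_⟩
    · have h1 := ih.2 n c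
      rw [hcb, hw] at h1
      push_cast at h1
      omega
    · cases n with
      | zero => exact (hw k 0 b).ge
      | succ n =>
        rcases b with b | b
        · exact (hw k (n + 1) b).ge
        · refine le_trans ?_ (ih.2 n b)
          push_cast
          omega

/-- The basis of an iterated mapping cone consists of the bases of the resolutions `R j`, shifted by
`j - k` in homological degree. -/
theorem IteratedCone.rank_eq {k : ℕ} {C : FreeComplex K V}
    {ε : C.X 0 →ₗ[MvPolynomial V K] G k} (h : IteratedCone δ R d k C ε) (n : ℕ) (a : V → ℤ) :
    C.rank n a =
      ∑ j ∈ Finset.Icc k d, if j ≤ n + k then (R j).complex.rank (n + k - j) a else 0 := by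
  induction h generalizing n with
  | base => simp
  | @step k C ε h φ hφ ih =>
    rw [← Finset.insert_Icc_add_one_left_eq_Icc ((Nat.le_succ k).trans h.le),
      Finset.sum_insert (by simp), if_pos (Nat.le_add_left k n), Nat.add_sub_cancel]
    cases n with
    | zero =>
      rw [FreeComplex.rank_cone_zero, Finset.sum_eq_zero, add_zero]
      intro j hj
      rw [if_neg]
      have := (Finset.mem_Icc.1 hj).1
      omega
    | succ n =>
      rw [FreeComplex.rank_cone_succ, ih, show n + 1 + k = n + (k + 1) by omega]

end IteratedCone

end Multigraded

namespace Colored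

/-! ### Color-squarefree monomials -/

section Monomials

variable {d : ℕ} {m : Fin d → ℕ}

theorem old_injective : Function.Injective (old : Var m → Var (succVec m)) := by
  rintro ⟨i, j⟩ ⟨i', j'⟩ h
  simp only [old, Sigma.mk.injEq] at h
  obtain ⟨rfl, h⟩ := h
  rw [Fin.castSucc_injective _ (eq_of_heq h)]

theorem new_injective : Function.Injective (new m) := fun _ _ h => congrArg Sigma.fst h

theorem old_ne_new (v : Var m) (i : Fin d) : old v ≠ new m i := by
  obtain ⟨i', j⟩ := v
  intro h
  simp only [old, new, Sigma.mk.injEq] at h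
  obtain ⟨rfl, h⟩ := h
  exact (Fin.castSucc_lt_last j).ne (eq_of_heq h)

theorem eq_old_or_new (v : Var (succVec m)) : (∃ w, v = old w) ∨ ∃ i, v = new m i := by
  obtain ⟨i, j⟩ := v
  induction j using Fin.lastCases with
  | last => exact Or.inr ⟨i, rfl⟩
  | cast j => exact Or.inl ⟨⟨i, j⟩, rfl⟩

theorem mem_cSupp {u : Var m →₀ ℕ} {i : Fin d} : i ∈ cSupp u ↔ ∃ v, u v ≠ 0 ∧ v.1 = i := by
  simp [cSupp]

theorem mapDomain_old_apply (u : Var m →₀ ℕ) (v : Var m) : u.mapDomain old (old v) = u v :=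
  Finsupp.mapDomain_apply old_injective u v

theorem mapDomain_new_apply (u : Var m →₀ ℕ) (i : Fin d) : u.mapDomain old (new m i) = 0 :=
  Finsupp.mapDomain_of_notMem_range u _ fun ⟨v, hv⟩ => old_ne_new v i hv

theorem shiftExp_old (u : Var m →₀ ℕ) (v : Var m) : shiftExp u (old v) = u v := by
  rw [shiftExp, Finsupp.add_apply, mapDomain_old_apply, Finsupp.finsetSum_apply,
    Finset.sum_eq_zero, add_zero]
  intro i _
  exact Finsupp.single_eq_of_ne (old_ne_new v i)

theorem shiftExp_new (u : Var m →₀ ℕ) (i : Fin d) :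
    shiftExp u (new m i) = if i ∈ cSupp u then 1 else 0 := by
  rw [shiftExp, Finsupp.add_apply, mapDomain_new_apply, zero_add, Finsupp.finsetSum_apply]
  simp only [Finsupp.single_apply, new_injective.eq_iff]
  rw [Finset.sum_ite_eq']

theorem shiftExp_le_iff {u : Var m →₀ ℕ} {e : Var (succVec m) →₀ ℕ} :
    shiftExp u ≤ e ↔ (∀ v, u v ≤ e (old v)) ∧ ∀ v, u v ≠ 0 → e (new m v.1) ≠ 0 := by
  constructor
  · intro h
    refine ⟨fun v => shiftExp_old u v ▸ h (old v), fun v hv h0 => ?_⟩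
    have := h (new m v.1)
    rw [shiftExp_new, if_pos (mem_cSupp.2 ⟨v, hv, rfl⟩), h0] at this
    omega
  · rintro ⟨h1, h2⟩ w
    obtain ⟨v, rfl⟩ | ⟨i, rfl⟩ := eq_old_or_new w
    · rw [shiftExp_old]
      exact h1 v
    · rw [shiftExp_new]
      split_ifs with h
      · obtain ⟨v, hv, rfl⟩ := mem_cSupp.1 h
        exact Nat.one_le_iff_ne_zero.2 (h2 v hv)
      · exact Nat.zero_le _

theorem IsColorSquarefree.of_le {u v : Var m →₀ ℕ} (h : IsColorSquarefree u) (hv : v ≤ u) :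
    IsColorSquarefree v :=
  ⟨fun e => (hv e).trans (h.1 e), fun i j k hj hk => h.2 i j k
    (fun h0 => hj (Nat.le_zero.1 (h0 ▸ hv _))) (fun h0 => hk (Nat.le_zero.1 (h0 ▸ hv _)))⟩

theorem IsColorSquarefree.eq_of_color {u : Var m →₀ ℕ} (h : IsColorSquarefree u) {v w : Var m}
    (hv : u v ≠ 0) (hw : u w ≠ 0) (hvw : v.1 = w.1) : v = w := by
  obtain ⟨i, j⟩ := v
  obtain ⟨i', k⟩ := w
  obtain rfl : i = i' := hvw
  rw [h.2 i j k hv hw]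

theorem IsColorSquarefree.notMem_cSupp {v : Var m →₀ ℕ} {x : Var m}
    (h : IsColorSquarefree (v + Finsupp.single x 1)) : x.1 ∉ cSupp v := by
  intro hx
  obtain ⟨w, hw, hwx⟩ := mem_cSupp.1 hx
  have := h.eq_of_color (v := w) (w := x) (by simp [hw]) (by simp) hwx
  subst this
  have := h.1 w
  rw [Finsupp.add_apply, Finsupp.single_eq_same] at this
  omega

theorem IsColorSquarefree.add_single {v : Var m →₀ ℕ} {x : Var m} (h : IsColorSquarefree v)
    (hx : x.1 ∉ cSupp v) : IsColorSquarefree (v + Finsupp.single x 1) := by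
  have h0 : ∀ w : Var m, w.1 = x.1 → v w = 0 := by
    intro w hw
    by_contra h1
    exact hx (mem_cSupp.2 ⟨w, h1, hw⟩)
  have hne : ∀ w : Var m, (v + Finsupp.single x 1 : Var m →₀ ℕ) w ≠ 0 → w.1 = x.1 → w = x := by
    intro w hw hwx
    by_contra hne
    rw [Finsupp.add_apply, h0 w hwx, Finsupp.single_eq_of_ne hne] at hw
    exact hw rfl
  refine ⟨fun w => ?_, fun i j k hj hk => ?_⟩
  · by_cases hw : w = x
    · subst hw
      rw [Finsupp.add_apply, h0 w rfl, Finsupp.single_eq_same]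
    · rw [Finsupp.add_apply, Finsupp.single_eq_of_ne hw, add_zero]
      exact h.1 w
  · by_cases hi : i = x.1
    · have h1 := (hne _ hj hi).trans (hne _ hk hi).symm
      exact eq_of_heq (Sigma.mk.inj h1).2
    · have h2 : ∀ l : Fin (m i), (⟨i, l⟩ : Var m) ≠ x := fun l hl => hi (congrArg Sigma.fst hl)
      rw [Finsupp.add_apply, Finsupp.single_eq_of_ne (h2 _), add_zero] at hj hk
      exact h.2 i j k hj hk

theorem cSupp_add_single (v : Var m →₀ ℕ) (x : Var m) :
    cSupp (v + Finsupp.single x 1) = insert x.1 (cSupp v) := by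
  ext i
  rw [Finset.mem_insert, mem_cSupp, mem_cSupp]
  constructor
  · rintro ⟨w, hw, rfl⟩
    by_cases hwx : w = x
    · exact Or.inl (congrArg Sigma.fst hwx)
    · rw [Finsupp.add_apply, Finsupp.single_eq_of_ne hwx, add_zero] at hw
      exact Or.inr ⟨w, hw, rfl⟩
  · rintro (rfl | ⟨w, hw, rfl⟩)
    · exact ⟨x, by simp, rfl⟩
    · exact ⟨w, by simp [hw], rfl⟩

theorem shiftExp_add_single {v : Var m →₀ ℕ} {x : Var m} (hx : x.1 ∉ cSupp v) :
    shiftExp (v + Finsupp.single x 1) =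
      Finsupp.single (old x) 1 + Finsupp.single (new m x.1) 1 + shiftExp v := by
  rw [shiftExp, cSupp_add_single, Finset.sum_insert hx, Finsupp.mapDomain_add,
    Finsupp.mapDomain_single, shiftExp]
  abel

theorem card_cSupp {u : Var m →₀ ℕ} (h : IsColorSquarefree u) : (cSupp u).card = u.degree := by
  rw [cSupp, Finset.card_image_of_injOn, Finsupp.degree_apply, Finset.card_eq_sum_ones]
  · refine Finset.sum_congr rfl fun v hv => ?_
    exact le_antisymm (Nat.one_le_iff_ne_zero.2 (Finsupp.mem_support_iff.1 hv)) (h.1 v)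
  · exact fun v hv w hw => h.eq_of_color (Finsupp.mem_support_iff.1 hv)
      (Finsupp.mem_support_iff.1 hw)

end Monomials

/-! ### The sequence in a fixed multidegree -/

section Boundary

variable {d : ℕ} {m : Fin d → ℕ} (K : Type*) [Field K]

/-- The sign with which the summand of `v x` is mapped to the summand of `v`. -/
def boundarySign (v : Var m →₀ ℕ) (x : Var m) : K :=
  (-1) ^ ((cSupp v).filter (fun i => i < x.1)).card

variable {K}

/-- The differential in a fixed multidegree, on coefficient functions. -/
def boundary (c : (Var m →₀ ℕ) → K) (v : Var m →₀ ℕ) : K :=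
  ∑ x : Var m, boundarySign K v x * c (v + Finsupp.single x 1)

/-- The coefficient functions which stand for the homogeneous elements, of the degree of the
monomial with exponent vector `e`, of the `k`-th module of the sequence. -/
def IsChain (e : Var (succVec m) →₀ ℕ) (k : ℕ) (c : (Var m →₀ ℕ) → K) : Prop :=
  ∀ u, c u ≠ 0 → IsColorSquarefree u ∧ u.degree = k ∧ shiftExp u ≤ e

variable {e : Var (succVec m) →₀ ℕ} {k : ℕ} {c : (Var m →₀ ℕ) → K}

theorem shiftExp_le_of_le {u v : Var m →₀ ℕ} (h : shiftExp u ≤ e) (hv : v ≤ u) :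
    shiftExp v ≤ e := by
  rw [shiftExp_le_iff] at h ⊢
  exact ⟨fun w => (hv w).trans (h.1 w),
    fun w hw => h.2 w fun h0 => hw (Nat.le_zero.1 (h0 ▸ hv w))⟩

theorem IsChain.boundary (hc : IsChain e (k + 1) c) : IsChain e k (boundary c) := by
  intro v hv
  obtain ⟨x, -, hx⟩ := Finset.exists_ne_zero_of_sum_ne_zero hv
  obtain ⟨h1, h2, h3⟩ := hc _ (right_ne_zero_of_mul hx)
  have hle : v ≤ v + Finsupp.single x 1 := le_self_add
  refine ⟨h1.of_le hle, ?_, shiftExp_le_of_le h3 hle⟩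
  rw [map_add, Finsupp.degree_single] at h2
  exact Nat.succ_injective h2

theorem boundarySign_add_single_of_lt {v : Var m →₀ ℕ} {x y : Var m} (hx : x.1 ∉ cSupp v)
    (h : x.1 < y.1) : boundarySign K (v + Finsupp.single x 1) y = -boundarySign K v y := by
  rw [boundarySign, boundarySign, cSupp_add_single, Finset.filter_insert, if_pos h,
    Finset.card_insert_of_notMem (fun h0 => hx (Finset.mem_filter.1 h0).1), pow_succ, mul_neg_one]

theorem boundarySign_add_single_of_le {v : Var m →₀ ℕ} {x y : Var m} (h : y.1 ≤ x.1) :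
    boundarySign K (v + Finsupp.single x 1) y = boundarySign K v y := by
  rw [boundarySign, boundarySign, cSupp_add_single, Finset.filter_insert, if_neg h.not_gt]

theorem boundarySign_mul_comm {v : Var m →₀ ℕ} {x y : Var m} (hx : x.1 ∉ cSupp v)
    (hxy : x.1 < y.1) :
    boundarySign K v x * boundarySign K (v + Finsupp.single x 1) y +
      boundarySign K v y * boundarySign K (v + Finsupp.single y 1) x = 0 := by
  rw [boundarySign_add_single_of_lt hx hxy, boundarySign_add_single_of_le hxy.le]
  ring

theorem boundary_boundary (hc : IsChain e k c) (v : Var m →₀ ℕ) :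
    boundary (boundary c) v = 0 := by
  have hexp : boundary (boundary c) v = ∑ p : Var m × Var m,
      boundarySign K v p.1 * boundarySign K (v + Finsupp.single p.1 1) p.2 *
        c (v + Finsupp.single p.1 1 + Finsupp.single p.2 1) := by
    rw [Fintype.sum_prod_type]
    simp only [boundary, Finset.mul_sum, mul_assoc]
  have hcolor : ∀ x y : Var m, c (v + Finsupp.single x 1 + Finsupp.single y 1) ≠ 0 →
      x.1 ∉ cSupp v ∧ x.1 ≠ y.1 := by
    intro x y h
    have h1 := (hc _ h).1
    have h2 := h1.notMem_cSupp
    rw [cSupp_add_single, Finset.mem_insert, not_or] at h2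
    exact ⟨(h1.of_le le_self_add).notMem_cSupp, Ne.symm h2.1⟩
  rw [hexp]
  -- The terms of `(x, y)` and `(y, x)` cancel; if `x` and `y` have the same color, the term is
  -- zero, so that the argument is valid in characteristic two as well.
  refine Finset.sum_involution (fun p _ => (p.2, p.1)) (fun p _ => ?_) (fun p _ hp h => ?_)
    (fun _ _ => Finset.mem_univ _) (fun _ _ => rfl)
  · obtain ⟨x, y⟩ := p
    dsimp only
    rw [add_right_comm v (Finsupp.single y 1), ← add_mul]
    by_cases h : c (v + Finsupp.single x 1 + Finsupp.single y 1) = 0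
    · rw [h, mul_zero]
    · have h1 := hcolor x y h
      rw [add_right_comm] at h
      have h2 := hcolor y x h
      rcases lt_or_gt_of_ne h1.2 with hlt | hlt
      · rw [boundarySign_mul_comm h1.1 hlt, zero_mul]
      · rw [add_comm, boundarySign_mul_comm h2.1 hlt, zero_mul]
  · have h1 := (hcolor _ _ (right_ne_zero_of_mul hp)).2
    exact h1 (congrArg (fun q => (Prod.snd q).1) h)

/-- The contraction by the variable `x`: multiplication of monomials by `x`. -/
def contraction (x : Var m) (c : (Var m →₀ ℕ) → K) (u : Var m →₀ ℕ) : K :=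
  if u x = 1 then c (u - Finsupp.single x 1) else 0

/-- The variable `x` and the additional variable of its color divide the monomial with exponent
vector `e`, which is divisible by no other variable of that color; and the color of `x` is the
first one with that property. -/
structure IsPivot (e : Var (succVec m) →₀ ℕ) (x : Var m) : Prop where
  old_ne_zero : e (old x) ≠ 0
  new_ne_zero : e (new m x.1) ≠ 0
  unique : ∀ y : Var m, y.1 = x.1 → e (old y) ≠ 0 → y = x
  first : ∀ y : Var m, e (old y) ≠ 0 → e (new m y.1) ≠ 0 → x.1 ≤ y.1

variable {x : Var m}

theorem IsPivot.first_of_le (hx : IsPivot e x) {u : Var m →₀ ℕ} (hu : shiftExp u ≤ e) {y : Var m}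
    (hy : u y ≠ 0) : x.1 ≤ y.1 := by
  rw [shiftExp_le_iff] at hu
  exact hx.first y (fun h => hy (Nat.le_zero.1 (h ▸ hu.1 y))) (hu.2 y hy)

theorem IsPivot.notMem_cSupp (hx : IsPivot e x) {u : Var m →₀ ℕ} (hu : shiftExp u ≤ e)
    (hux : u x = 0) : x.1 ∉ cSupp u := by
  intro h
  obtain ⟨y, hy, hyx⟩ := mem_cSupp.1 h
  rw [shiftExp_le_iff] at hu
  have := hx.unique y hyx (fun h => hy (Nat.le_zero.1 (h ▸ hu.1 y)))
  exact hy (this ▸ hux)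

theorem IsPivot.boundarySign_eq_one (hx : IsPivot e x) {u : Var m →₀ ℕ} (hu : shiftExp u ≤ e) :
    boundarySign K u x = 1 := by
  rw [boundarySign, Finset.filter_eq_empty_iff.2, Finset.card_empty, pow_zero]
  intro i hi
  obtain ⟨y, hy, rfl⟩ := mem_cSupp.1 hi
  exact (hx.first_of_le hu hy).not_gt

theorem IsPivot.isChain_contraction (hx : IsPivot e x) (hc : IsChain e k c) :
    IsChain e (k + 1) (contraction x c) := by
  intro u hu
  rw [contraction] at hu
  split_ifs at hu with hux
  · obtain ⟨v, rfl⟩ : ∃ v, u = v + Finsupp.single x 1 :=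
      ⟨u - Finsupp.single x 1, (tsub_add_cancel_of_le
        (Finsupp.single_le_iff.2 hux.ge)).symm⟩
    rw [add_tsub_cancel_right] at hu
    rw [Finsupp.add_apply, Finsupp.single_eq_same, Nat.add_eq_right] at hux
    obtain ⟨h1, h2, h3⟩ := hc v hu
    refine ⟨h1.add_single (hx.notMem_cSupp h3 hux), by rw [map_add, h2, Finsupp.degree_single], ?_⟩
    rw [shiftExp_le_iff] at h3 ⊢
    refine ⟨fun y => ?_, fun y hy => ?_⟩ <;> by_cases hyx : y = x
    · subst hyx
      rw [Finsupp.add_apply, hux, Finsupp.single_eq_same]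
      exact Nat.one_le_iff_ne_zero.2 hx.old_ne_zero
    · rw [Finsupp.add_apply, Finsupp.single_eq_of_ne hyx]
      exact h3.1 y
    · subst hyx
      exact hx.new_ne_zero
    · rw [Finsupp.add_apply, Finsupp.single_eq_of_ne hyx] at hy
      exact h3.2 y hy
  · exact absurd rfl hu

/-- At monomials that are not divisible by `x`, no cycle condition is needed: only the variable `x`
contributes to the boundary of the contraction. -/
theorem IsPivot.boundary_contraction_of_eq_zero (hx : IsPivot e x) (hc : IsChain e k c)
    {v : Var m →₀ ℕ} (hv : v x = 0) : boundary (contraction x c) v = c v := by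
  rw [boundary, Finset.sum_eq_single x]
  · rw [contraction, Finsupp.add_apply, hv, Finsupp.single_eq_same, zero_add, if_pos rfl,
      add_tsub_cancel_right]
    by_cases h : c v = 0
    · rw [h, mul_zero]
    · rw [hx.boundarySign_eq_one (hc v h).2.2, one_mul]
  · intro y _ hy
    rw [contraction, Finsupp.add_apply, hv, Finsupp.single_eq_of_ne hy.symm, if_neg (by simp),
      mul_zero]
  · exact fun h => absurd (Finset.mem_univ x) h

/-- On cycles, `contraction x` is a right inverse of the differential. -/
theorem IsPivot.boundary_contraction (hx : IsPivot e x) (hc : IsChain e k c)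
    (h0 : ∀ w, boundary c w = 0) (v : Var m →₀ ℕ) : boundary (contraction x c) v = c v := by
  by_cases hv : v x = 0
  · exact hx.boundary_contraction_of_eq_zero hc hv
  obtain ⟨w, rfl⟩ : ∃ w, v = w + Finsupp.single x 1 :=
    ⟨v - Finsupp.single x 1, (tsub_add_cancel_of_le
      (Finsupp.single_le_iff.2 (Nat.one_le_iff_ne_zero.2 hv))).symm⟩
  by_cases hw : w x = 0
  -- The boundary of `c` at `v / x` vanishes. Its term for `x` is the coefficient of `v`, and its
  -- other terms are the negatives of those of the boundary of the contraction at `v`.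
  · rw [← sub_eq_zero, ← neg_eq_zero, neg_sub, ← h0 w]
    rw [boundary, boundary, ← Finset.add_sum_erase _ _ (Finset.mem_univ x),
      ← Finset.add_sum_erase _ _ (Finset.mem_univ x)]
    have h1 : boundarySign K w x * c (w + Finsupp.single x 1) = c (w + Finsupp.single x 1) := by
      by_cases h : c (w + Finsupp.single x 1) = 0
      · rw [h, mul_zero]
      · rw [hx.boundarySign_eq_one (shiftExp_le_of_le (hc _ h).2.2 le_self_add), one_mul]
    have h2 : contraction x c (w + Finsupp.single x 1 + Finsupp.single x 1) = 0 := by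
      rw [contraction, if_neg]
      simp
    rw [h1, h2, mul_zero, zero_add, sub_eq_add_neg, ← Finset.sum_neg_distrib]
    refine congrArg _ (Finset.sum_congr rfl fun y hy => ?_)
    have hyx := Finset.ne_of_mem_erase hy
    have h3 : contraction x c (w + Finsupp.single x 1 + Finsupp.single y 1) =
        c (w + Finsupp.single y 1) := by
      rw [add_right_comm, contraction, if_pos, add_tsub_cancel_right]
      simp [hw, Finsupp.single_eq_of_ne hyx.symm]
    rw [h3]
    by_cases h : c (w + Finsupp.single y 1) = 0
    · rw [h, mul_zero, mul_zero, neg_zero]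
    have h4 := (hc _ h).2.2
    have hlt : x.1 < y.1 := by
      refine lt_of_le_of_ne (hx.first_of_le h4 (y := y) (by simp)) fun hxy => hyx ?_
      rw [shiftExp_le_iff] at h4
      refine hx.unique y hxy.symm fun h5 => ?_
      have := h4.1 y
      rw [h5, Finsupp.add_apply, Finsupp.single_eq_same] at this
      omega
    rw [boundarySign_add_single_of_lt
      (hx.notMem_cSupp (shiftExp_le_of_le h4 le_self_add) hw) hlt, neg_mul, neg_neg]
  · have h1 : c (w + Finsupp.single x 1) = 0 := by
      by_contra h
      have := (hc _ h).1.1 x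
      rw [Finsupp.add_apply, Finsupp.single_eq_same] at this
      omega
    rw [h1]
    refine Finset.sum_eq_zero fun y _ => ?_
    rw [contraction, if_neg, mul_zero]
    rw [Finsupp.add_apply, Finsupp.add_apply, Finsupp.single_eq_same]
    omega

end Boundary

/-! ### The ideals of the sequence -/

section Ideals

variable {K : Type*} [Field K] {d : ℕ} {m : Fin d → ℕ}

theorem span_sup_span_monomial {V : Type*} (A B : Set (V →₀ ℕ)) :
    Ideal.span ((fun e => monomial e (1 : K)) '' A) ⊔
        Ideal.span ((fun e => monomial e (1 : K)) '' B) =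
      Ideal.span ((fun e => monomial e (1 : K)) '' (A ∪ B)) := by
  rw [Set.image_union, Ideal.span_union]

theorem X_mul_X_eq_monomial {V : Type*} (v w : V) :
    (X v * X w : MvPolynomial V K) = monomial (Finsupp.single v 1 + Finsupp.single w 1) 1 := by
  rw [X, X, monomial_mul, one_mul]

theorem polSquares_eq : polSquares K m = Ideal.span ((fun e => monomial e (1 : K)) ''
    {e | ∃ (i : Fin d) (j k : Fin (m i)), j < k ∧
      e = Finsupp.single (old ⟨i, j⟩) 1 + Finsupp.single (old ⟨i, k⟩) 1}) := by
  rw [polSquares]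
  congr 1
  ext f
  constructor
  · rintro ⟨i, j, k, hjk, rfl⟩
    exact ⟨_, ⟨i, j, k, hjk, rfl⟩, (X_mul_X_eq_monomial _ _).symm⟩
  · rintro ⟨_, ⟨i, j, k, hjk, rfl⟩, rfl⟩
    exact ⟨i, j, k, hjk, (X_mul_X_eq_monomial _ _).symm⟩

theorem newIdeal_eq : newIdeal K m = Ideal.span ((fun e => monomial e (1 : K)) ''
    {e | ∃ (i : Fin d) (j : Fin (m i)),
      e = Finsupp.single (new m i) 1 + Finsupp.single (old ⟨i, j⟩) 1}) := by
  rw [newIdeal]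
  congr 1
  ext f
  constructor
  · rintro ⟨i, j, rfl⟩
    exact ⟨_, ⟨i, j, rfl⟩, (X_mul_X_eq_monomial _ _).symm⟩
  · rintro ⟨_, ⟨i, j, rfl⟩, rfl⟩
    exact ⟨i, j, (X_mul_X_eq_monomial _ _).symm⟩

theorem map_rename_span (A : Set (Var m →₀ ℕ)) :
    (Ideal.span ((fun u => monomial u (1 : K)) '' A)).map
        (rename (old : Var m → Var (succVec m)) : P K m →ₐ[K] P' K m) =
      Ideal.span ((fun e => monomial e (1 : K)) '' (Finsupp.mapDomain old '' A)) := by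
  rw [Ideal.map_span, Set.image_image, Set.image_image]
  congr 1
  refine Set.image_congr fun u _ => ?_
  exact rename_monomial _ _ _

/-- What the exactness of the sequence requires of an ideal of `P'`: it is a monomial ideal,
extended from `P`, that contains the products of two variables of `P` of the same color. -/
structure IsColored (J : Ideal (P' K m)) : Prop where
  exists_generators : ∃ A : Set (Var (succVec m) →₀ ℕ),
    J = Ideal.span ((fun e => monomial e (1 : K)) '' A) ∧ ∀ a ∈ A, ∀ i, a (new m i) = 0
  mul_mem : ∀ (e : Var (succVec m) →₀ ℕ) (v w : Var m), v.1 = w.1 → v ≠ w → e (old v) ≠ 0 →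
    e (old w) ≠ 0 → monomial e (1 : K) ∈ J

theorem isColored_primeIdeal {I : Ideal (P K m)} (hI : IsColorSquarefreeIdeal I) :
    IsColored (primeIdeal I) where
  exists_generators := by
    obtain ⟨⟨A, rfl⟩, -⟩ := hI
    refine ⟨_, by rw [primeIdeal, map_rename_span, polSquares_eq, span_sup_span_monomial], ?_⟩
    rintro a (⟨u, -, rfl⟩ | ⟨i, j, k, -, rfl⟩) i'
    · exact mapDomain_new_apply u i'
    · rw [Finsupp.add_apply, Finsupp.single_eq_of_ne (old_ne_new _ _).symm,
        Finsupp.single_eq_of_ne (old_ne_new _ _).symm, zero_add]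
  mul_mem := by
    have key : ∀ (e : Var (succVec m) →₀ ℕ) (i : Fin d) (j k : Fin (m i)), j < k →
        e (old ⟨i, j⟩) ≠ 0 → e (old ⟨i, k⟩) ≠ 0 → monomial e (1 : K) ∈ primeIdeal I := by
      intro e i j k hjk hj hk
      refine polSquares_le_primeIdeal I ?_
      rw [polSquares_eq, monomial_mem_span_iff]
      refine ⟨_, ⟨i, j, k, hjk, rfl⟩, fun v => ?_⟩
      have hne : (old ⟨i, j⟩ : Var (succVec m)) ≠ old ⟨i, k⟩ := fun h =>
        hjk.ne (eq_of_heq (Sigma.mk.inj (old_injective h)).2)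
      rw [Finsupp.add_apply, Finsupp.single_apply, Finsupp.single_apply]
      split_ifs with h1 h2 h2
      · exact absurd (h1.trans h2.symm) hne
      · subst h1; omega
      · subst h2; omega
      · omega
    rintro e ⟨i, j⟩ ⟨i', k⟩ rfl hne hj hk
    rcases lt_trichotomy j k with h | rfl | h
    · exact key e i j k h hj hk
    · exact absurd rfl hne
    · exact key e i k j h hk hj

namespace IsColored

variable {J : Ideal (P' K m)}

theorem isMonomialIdeal (hJ : IsColored J) : IsMonomialIdeal J := by
  obtain ⟨A, rfl, -⟩ := hJ.exists_generators
  exact isMonomialIdeal_span A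

theorem isMonomialIdeal_sup_newIdeal (hJ : IsColored J) : IsMonomialIdeal (J ⊔ newIdeal K m) := by
  obtain ⟨A, rfl, -⟩ := hJ.exists_generators
  rw [newIdeal_eq, span_sup_span_monomial]
  exact isMonomialIdeal_span _

/-- Membership of a monomial does not depend on the exponents of the additional variables. -/
theorem monomial_mem (hJ : IsColored J) {e e' : Var (succVec m) →₀ ℕ} (he : monomial e (1 : K) ∈ J)
    (h : ∀ v : Var m, e (old v) ≤ e' (old v)) : monomial e' (1 : K) ∈ J := by
  obtain ⟨A, rfl, hA⟩ := hJ.exists_generators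
  rw [monomial_mem_span_iff] at he ⊢
  obtain ⟨a, ha, hae⟩ := he
  refine ⟨a, ha, fun w => ?_⟩
  obtain ⟨v, rfl⟩ | ⟨i, rfl⟩ := eq_old_or_new w
  · exact (hae _).trans (h v)
  · rw [hA a ha]
    exact Nat.zero_le _

theorem exists_of_mem_sup_newIdeal (hJ : IsColored J) {e : Var (succVec m) →₀ ℕ}
    (he : monomial e (1 : K) ∈ J ⊔ newIdeal K m) (h : monomial e (1 : K) ∉ J) :
    ∃ v : Var m, e (old v) ≠ 0 ∧ e (new m v.1) ≠ 0 := by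
  obtain ⟨A, rfl, -⟩ := hJ.exists_generators
  rw [newIdeal_eq, span_sup_span_monomial, monomial_mem_span_iff] at he
  obtain ⟨a, ha | ⟨i, j, rfl⟩, hae⟩ := he
  · exact absurd (monomial_mem_span_iff.2 ⟨a, ha, hae⟩) h
  · refine ⟨⟨i, j⟩, fun h0 => ?_, fun h0 => ?_⟩
    · have := hae (old ⟨i, j⟩)
      rw [h0, Finsupp.add_apply, Finsupp.single_eq_same] at this
      omega
    · have := hae (new m i)
      rw [h0, Finsupp.add_apply, Finsupp.single_eq_same] at this
      omega

end IsColored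

theorem mem_colonMon {J : Ideal (P' K m)} {u : Var m →₀ ℕ} {f : P' K m} :
    f ∈ colonMon J u ↔ f * mono' K u ∈ J := by
  rw [colonMon, Submodule.mem_colon_singleton, smul_eq_mul]

theorem monomial_mem_colonMon {J : Ideal (P' K m)} {u : Var m →₀ ℕ} {e : Var (succVec m) →₀ ℕ} :
    monomial e (1 : K) ∈ colonMon J u ↔ monomial (e + u.mapDomain old) (1 : K) ∈ J := by
  rw [mem_colonMon, mono', monomial_mul, one_mul]

theorem _root_.Multigraded.IsMonomialIdeal.colonMon {J : Ideal (P' K m)} (hJ : IsMonomialIdeal J)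
    (u : Var m →₀ ℕ) : IsMonomialIdeal (colonMon J u) := by
  intro f hf e he
  rw [mem_colonMon] at hf
  rw [monomial_mem_colonMon]
  refine hJ _ hf _ ?_
  rwa [mono', coeff_mul_monomial, mul_one]

theorem mem_of_forall_monomial_mem {V : Type*} {J : Ideal (MvPolynomial V K)} {f : MvPolynomial V K}
    (h : ∀ e, coeff e f ≠ 0 → monomial e (1 : K) ∈ J) : f ∈ J := by
  rw [as_sum f]
  exact sum_mem fun e he => monomial_mem_of_one (h e (mem_support_iff.1 he)) _

namespace IsColored

variable {J : Ideal (P' K m)}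

/-- The additional variables are regular modulo the colon ideals. -/
theorem mem_colonMon_of_X_mul_mem (hJ : IsColored J) (u : Var m →₀ ℕ) (i : Fin d) {f : P' K m}
    (hf : X (new m i) * f ∈ colonMon J u) : f ∈ colonMon J u := by
  refine mem_of_forall_monomial_mem fun e he => ?_
  have h := hJ.isMonomialIdeal.colonMon u _ hf (Finsupp.single (new m i) 1 + e)
    (by rwa [coeff_X_mul])
  rw [monomial_mem_colonMon] at h ⊢
  refine hJ.monomial_mem h fun v => ?_
  rw [Finsupp.add_apply, Finsupp.add_apply, Finsupp.add_apply,
    Finsupp.single_eq_of_ne (old_ne_new v i), zero_add]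

/-- The degrees of the basis elements of a minimal resolution of `P' / (J : u)` do not involve the
additional variables. -/
theorem deg_new_eq_zero (hJ : IsColored J) (u : Var m →₀ ℕ)
    (R : MinimalResolution K (cyclicGrading (colonMon J u) 0)) (i : Fin d) (n : ℕ)
    (b : R.complex.ι n) : R.complex.deg n b (new m i) = 0 := by
  refine R.deg_apply_eq_zero (fun a x hx ha => ?_) (fun a x hx ha => ?_) (fun x hx => ?_) n b
  · obtain ⟨f, hf, rfl⟩ := hx
    by_cases h0 : f = 0
    · exact ⟨0, by rw [h0, smul_zero, map_zero]⟩
    obtain ⟨e, he, hfe⟩ := exists_monomial_of_mem_polyPart hf h0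
    have h1 : Finsupp.single (new m i) 1 ≤ e := by
      rw [Finsupp.single_le_iff]
      have := congrFun he (new m i)
      simp only [expDeg, sub_zero] at this
      omega
    refine ⟨Ideal.Quotient.mk _ (monomial (e - Finsupp.single (new m i) 1) (coeff e f)), ?_⟩
    have : X (new m i) * monomial (e - Finsupp.single (new m i) 1) (coeff e f) = f := by
      rw [X, monomial_mul, one_mul, add_tsub_cancel_of_le h1, ← hfe]
    exact congrArg (Ideal.Quotient.mk (colonMon J u)) this
  · obtain ⟨f, hf, rfl⟩ := hx
    rw [eq_zero_of_mem_polyPart hf (v := new m i) (by simpa using ha), map_zero]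
  · obtain ⟨f, rfl⟩ := Ideal.Quotient.mk_surjective x
    refine Ideal.Quotient.eq_zero_iff_mem.2 (hJ.mem_colonMon_of_X_mul_mem u i ?_)
    exact Ideal.Quotient.eq_zero_iff_mem.1 hx

end IsColored

end Ideals

/-! ### The differentials -/

section Diff

variable {K : Type*} [Field K] {d : ℕ} {m : Fin d → ℕ} (J : Ideal (P' K m))

theorem mulMap_mk (u v : Var m →₀ ℕ) (x : Var m) (h : u = v + Finsupp.single x 1) (f : P' K m) :
    mulMap J u v x h (Ideal.Quotient.mk _ f) =
      Ideal.Quotient.mk _ (X (old x) * X (new m x.1) * f) := rfl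

open Classical in
/-- The component of the differential in the summand of `v`, as a sum over the variables. -/
theorem diff_apply (k : ℕ) (y : G J (k + 1)) (v : MonCS m k) :
    diff J k y v = ∑ x : Var m,
      if h : IsColorSquarefree (v.1 + Finsupp.single x 1) then
        ((-1 : P' K m) ^ ((cSupp v.1).filter (fun i => i < x.1)).card) •
          mulMap J _ v.1 x rfl (y ⟨v.1 + Finsupp.single x 1, h, by
            rw [map_add, v.2.2, Finsupp.degree_single]⟩)
      else 0 := by
  rw [diff, LinearMap.pi_apply, LinearMap.sum_apply]
  simp only [LinearMap.sum_apply]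
  rw [Finset.sum_comm]
  refine Finset.sum_congr rfl fun x _ => ?_
  split_ifs with h
  · rw [Finset.sum_eq_single ⟨v.1 + Finsupp.single x 1, h, by
      rw [map_add, v.2.2, Finsupp.degree_single]⟩]
    · rw [dif_pos rfl, cSupp_add_single, Finset.filter_insert, if_neg (lt_irrefl _)]
      rfl
    · intro u _ hu
      rw [dif_neg fun h' => hu (Subtype.ext h'), LinearMap.zero_apply]
    · exact fun h' => absurd (Finset.mem_univ _) h'
  · refine Finset.sum_eq_zero fun u _ => ?_
    rw [dif_neg, LinearMap.zero_apply]
    intro h'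
    exact h (h' ▸ u.2.1)

theorem projG_apply {J₁ J₂ : Ideal (P' K m)} (h : J₁ ≤ J₂) (k : ℕ) (y : G J₁ k) (u : MonCS m k) :
    projG h k y u = Submodule.mapQ (colonMon J₁ u.1) (colonMon J₂ u.1) LinearMap.id
      (Submodule.colon_mono h subset_rfl) (y u) := rfl

theorem mapQ_colonMon_mk {J₁ J₂ : Ideal (P' K m)} (h : J₁ ≤ J₂) (u : Var m →₀ ℕ) (f : P' K m) :
    Submodule.mapQ (colonMon J₁ u) (colonMon J₂ u) LinearMap.id
      (Submodule.colon_mono h subset_rfl) (Ideal.Quotient.mk _ f) = Ideal.Quotient.mk _ f := rfl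

theorem mapQ_mulMap {J₁ J₂ : Ideal (P' K m)} (h : J₁ ≤ J₂) (u v : Var m →₀ ℕ) (x : Var m)
    (hu : u = v + Finsupp.single x 1) (z : P' K m ⧸ colonMon J₁ u) :
    Submodule.mapQ (colonMon J₁ v) (colonMon J₂ v) LinearMap.id
      (Submodule.colon_mono h subset_rfl) (mulMap J₁ u v x hu z) =
    mulMap J₂ u v x hu (Submodule.mapQ (colonMon J₁ u) (colonMon J₂ u) LinearMap.id
      (Submodule.colon_mono h subset_rfl) z) := by
  obtain ⟨f, rfl⟩ := Ideal.Quotient.mk_surjective z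
  rw [mulMap_mk, mapQ_colonMon_mk h, mapQ_colonMon_mk h, mulMap_mk]

theorem projG_diff {J₁ J₂ : Ideal (P' K m)} (h : J₁ ≤ J₂) (k : ℕ) (y : G J₁ (k + 1)) :
    projG h k (diff J₁ k y) = diff J₂ k (projG h (k + 1) y) := by
  funext v
  rw [projG_apply, diff_apply, diff_apply, map_sum]
  refine Finset.sum_congr rfl fun x _ => ?_
  split_ifs with hx
  · rw [LinearMap.map_smul, mapQ_mulMap h, projG_apply]
  · rw [LinearMap.map_zero]

theorem augG_diff (y : G J 1) : augG J (diff J 0 y) = 0 := by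
  rw [augG, LinearMap.comp_apply, LinearMap.proj_apply, diff_apply, map_sum]
  refine Finset.sum_eq_zero fun x _ => ?_
  split_ifs with hx
  · rw [map_smul]
    generalize y _ = z
    obtain ⟨f, rfl⟩ := Ideal.Quotient.mk_surjective z
    refine smul_eq_zero_of_right _ (Ideal.Quotient.eq_zero_iff_mem.2 ?_)
    refine Ideal.mem_sup_right (Ideal.mul_mem_right _ _ (Ideal.subset_span ⟨x.1, x.2, ?_⟩))
    exact mul_comm _ _
  · exact map_zero _

theorem augG_surjective : Function.Surjective (augG J) := by
  intro y
  obtain ⟨f, rfl⟩ := Ideal.Quotient.mk_surjective y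
  exact ⟨fun _ => Ideal.Quotient.mk _ f, rfl⟩

theorem preservesDegree_augG : PreservesDegree (grG J 0) (cyclicGrading (J ⊔ newIdeal K m) 0)
    (augG J) := by
  intro a y hy
  obtain ⟨f, hf, hfy⟩ := hy (oneMon m)
  refine ⟨f, ?_, ?_⟩
  · have : shiftDeg (oneMon m).1 = 0 := by
      simp [shiftDeg, shiftExp, oneMon, cSupp]
    rwa [this] at hf
  · rw [augG, LinearMap.comp_apply, LinearMap.proj_apply, ← hfy]
    rfl

theorem neg_one_pow_mem_polyPart {V : Type*} [DecidableEq V] (n : ℕ) :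
    ((-1) ^ n : MvPolynomial V K) ∈ polyPart K 0 := by
  rcases neg_one_pow_eq_or (MvPolynomial V K) n with h | h <;> rw [h]
  · exact one_mem_polyPart
  · exact neg_mem one_mem_polyPart

theorem shiftDeg_add_single {v : Var m →₀ ℕ} {x : Var m} (hx : x.1 ∉ cSupp v) :
    shiftDeg (v + Finsupp.single x 1) =
      expDeg (Finsupp.single (old x) 1 + Finsupp.single (new m x.1) 1) + shiftDeg v := by
  rw [shiftDeg, shiftExp_add_single hx, expDeg_add, shiftDeg]

theorem preservesDegree_diff (k : ℕ) :
    PreservesDegree (grG J (k + 1)) (grG J k) (diff J k) := by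
  intro a y hy v
  rw [diff_apply]
  refine sum_mem fun x _ => ?_
  split_ifs with hx
  · obtain ⟨f, hf, hfy⟩ := hy ⟨v.1 + Finsupp.single x 1, hx, by
      rw [map_add, v.2.2, Finsupp.degree_single]⟩
    rw [← hfy]
    refine ⟨(-1) ^ ((cSupp v.1).filter (fun i => i < x.1)).card *
      (X (old x) * X (new m x.1) * f), ?_, rfl⟩
    have h1 : (X (old x) * X (new m x.1) : P' K m) ∈
        polyPart K (expDeg (Finsupp.single (old x) 1 + Finsupp.single (new m x.1) 1)) := by
      rw [X_mul_X_eq_monomial]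
      exact monomial_mem_polyPart _ _
    have h2 := mul_mem_polyPart (neg_one_pow_mem_polyPart
      ((cSupp v.1).filter (fun i => i < x.1)).card) (mul_mem_polyPart h1 hf)
    rw [shiftDeg_add_single hx.notMem_cSupp, zero_add, add_comm, sub_add,
      add_sub_cancel_left] at h2
    exact h2
  · exact zero_mem _

theorem subsingleton_G {k : ℕ} (hk : d < k) : Subsingleton (G J k) := by
  have : IsEmpty (MonCS m k) := by
    refine ⟨fun u => ?_⟩
    have h := Finset.card_le_univ (cSupp u.1)
    rw [card_cSupp u.2.1, u.2.2, Fintype.card_fin] at h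
    omega
  infer_instance

end Diff

/-! ### Exactness of the sequence -/

section Exactness

variable {K : Type*} [Field K] {d : ℕ} {m : Fin d → ℕ} {J : Ideal (P' K m)}

theorem isGrading_grG (hJ : IsColored J) (k : ℕ) : IsGrading K (grG J k) :=
  isGrading_pi fun u => isGrading_cyclic (hJ.isMonomialIdeal.colonMon u.1) _

section Chain

variable (J) in
/-- The element of the `k`-th module with the given coefficient function, homogeneous of the degree
of the monomial with exponent vector `e`. The truncated subtraction does no harm: the
coefficients of a chain vanish where it truncates. -/
def ofChain (e : Var (succVec m) →₀ ℕ) (k : ℕ) (c : (Var m →₀ ℕ) → K) : G J k :=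
  fun u => Ideal.Quotient.mk _ (monomial (e - shiftExp u.1) (c u.1))

variable {e : Var (succVec m) →₀ ℕ} {k : ℕ} {c : (Var m →₀ ℕ) → K}

/-- On coefficient functions the differential is `boundary`. -/
theorem diff_ofChain (hc : IsChain e (k + 1) c) :
    diff J k (ofChain J e (k + 1) c) = ofChain J e k (boundary c) := by
  funext v
  rw [diff_apply, ofChain, boundary, map_sum, map_sum]
  refine Finset.sum_congr rfl fun x _ => ?_
  split_ifs with h
  · have h1 : (-1 : P' K m) ^ ((cSupp v.1).filter (fun i => i < x.1)).card *
        (X (old x) * X (new m x.1) *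
          monomial (e - shiftExp (v.1 + Finsupp.single x 1)) (c (v.1 + Finsupp.single x 1))) =
        monomial (e - shiftExp v.1) (boundarySign K v.1 x * c (v.1 + Finsupp.single x 1)) := by
      by_cases h0 : c (v.1 + Finsupp.single x 1) = 0
      · rw [h0, map_zero, mul_zero, mul_zero, mul_zero, map_zero]
      have hle := (hc _ h0).2.2
      have hs := shiftExp_add_single h.notMem_cSupp
      rw [X_mul_X_eq_monomial, monomial_mul, one_mul, boundarySign, ← C_mul_monomial, map_pow,
        map_neg, map_one]
      congr 2
      rw [hs] at hle ⊢
      rw [← tsub_tsub, tsub_right_comm]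
      exact congrArg _ (add_tsub_cancel_of_le (le_tsub_of_add_le_right hle))
    rw [← h1]
    rfl
  · have h0 : c (v.1 + Finsupp.single x 1) = 0 := by
      by_contra h0
      exact h (hc _ h0).1
    rw [h0, mul_zero, map_zero, map_zero]

/-- The elements whose degree is that of a monomial are given by coefficient functions. -/
theorem exists_eq_ofChain {y : G J k} (hy : y ∈ grG J k (expDeg e)) :
    ∃ c, IsChain e k c ∧ y = ofChain J e k c := by
  classical
  choose f hf hfy using hy
  refine ⟨fun u => if h : IsColorSquarefree u ∧ u.degree = k then
    (if shiftExp u ≤ e then coeff (e - shiftExp u) (f ⟨u, h⟩) else 0) else 0, ?_, ?_⟩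
  · intro u hu
    dsimp only at hu
    split_ifs at hu with h1 h2
    · exact ⟨h1.1, h1.2, h2⟩
    · exact absurd rfl hu
    · exact absurd rfl hu
  · funext u
    rw [← hfy u, ofChain, dif_pos u.2]
    have hfu := hf u
    split_ifs with h
    · have h1 : expDeg e - shiftDeg u.1 = expDeg (e - shiftExp u.1) := by
        rw [sub_eq_iff_eq_add, shiftDeg, ← expDeg_add, tsub_add_cancel_of_le h]
      rw [h1] at hfu
      exact congrArg (Ideal.Quotient.mk _) (eq_monomial_of_mem_polyPart hfu)
    · rw [Finsupp.le_def, not_forall] at h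
      obtain ⟨w, hw⟩ := h
      have : f u = 0 := by
        refine eq_zero_of_mem_polyPart hfu (v := w) ?_
        simp only [Pi.sub_apply, shiftDeg, expDeg]
        omega
      rw [this, map_zero, map_zero, map_zero]

theorem eq_zero_of_mem_grG {a : Var (succVec m) → ℤ} {w : Var (succVec m)} (ha : a w < 0)
    {y : G J k} (hy : y ∈ grG J k a) : y = 0 := by
  funext u
  obtain ⟨f, hf, hfy⟩ := hy u
  rw [← hfy, eq_zero_of_mem_polyPart hf (v := w), map_zero]
  · rfl
  · simp only [Pi.sub_apply, shiftDeg, expDeg]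
    omega

theorem eq_zero_or_exists_ofChain {a : Var (succVec m) → ℤ} {y : G J k} (hy : y ∈ grG J k a) :
    y = 0 ∨ ∃ e c, IsChain e k c ∧ y = ofChain J e k c := by
  by_cases ha : ∃ w, a w < 0
  · obtain ⟨w, hw⟩ := ha
    exact Or.inl (eq_zero_of_mem_grG hw hy)
  · push Not at ha
    have : a = expDeg (Finsupp.equivFunOnFinite.symm fun w => (a w).toNat) := by
      funext w
      simp [expDeg, ha w]
    rw [this] at hy
    exact Or.inr ⟨_, exists_eq_ofChain hy⟩

/-- In a degree whose monomial lies in `J` the modules vanish; in all others the coefficient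
function is determined by the element. -/
theorem ofChain_eq_zero_iff (hJ : IsColored J) (hc : IsChain e k c) :
    ofChain J e k c = 0 ↔ monomial e (1 : K) ∈ J ∨ ∀ u, c u = 0 := by
  have key : ∀ u : Var m →₀ ℕ, shiftExp u ≤ e → (monomial (e - shiftExp u) (1 : K) ∈ colonMon J u ↔
      monomial e (1 : K) ∈ J) := by
    intro u hu
    have h : ∀ v : Var m, (e - shiftExp u + u.mapDomain old) (old v) = e (old v) := by
      intro v
      have := hu (old v)
      rw [shiftExp_old] at this
      rw [Finsupp.add_apply, Finsupp.tsub_apply, shiftExp_old, mapDomain_old_apply,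
        tsub_add_cancel_of_le this]
    rw [monomial_mem_colonMon]
    exact ⟨fun h' => hJ.monomial_mem h' fun v => (h v).le,
      fun h' => hJ.monomial_mem h' fun v => (h v).ge⟩
  constructor
  · intro h
    by_contra hne
    push Not at hne
    obtain ⟨he, u, hu⟩ := hne
    obtain ⟨h1, h2, h3⟩ := hc u hu
    have hmem := Ideal.Quotient.eq_zero_iff_mem.1 (congrFun h ⟨u, h1, h2⟩)
    refine he ((key u h3).1 (hJ.isMonomialIdeal.colonMon u _ hmem _ ?_))
    rwa [coeff_monomial, if_pos rfl]
  · intro h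
    funext u
    refine Ideal.Quotient.eq_zero_iff_mem.2 ?_
    by_cases h0 : c u.1 = 0
    · rw [h0, map_zero]
      exact zero_mem _
    · rcases h with h | h
      · exact monomial_mem_of_one ((key u.1 (hc _ h0).2.2).2 h) _
      · exact absurd (h u.1) h0

/-- The color of a pivot is chosen minimal. Uniqueness of the variable holds since `J` contains the
products of two variables of the same color. -/
theorem exists_isPivot (hJ : IsColored J) (he : monomial e (1 : K) ∉ J)
    (h : ∃ v : Var m, e (old v) ≠ 0 ∧ e (new m v.1) ≠ 0) : ∃ x, IsPivot e x := by
  classical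
  obtain ⟨x, hx, hmin⟩ := Finset.exists_min_image
    (Finset.univ.filter fun v : Var m => e (old v) ≠ 0 ∧ e (new m v.1) ≠ 0) Sigma.fst (by
      obtain ⟨v, hv⟩ := h
      exact ⟨v, Finset.mem_filter.2 ⟨Finset.mem_univ _, hv⟩⟩)
  have hx := (Finset.mem_filter.1 hx).2
  refine ⟨x, hx.1, hx.2, fun y hyx hy => ?_, fun y h1 h2 =>
    hmin y (Finset.mem_filter.2 ⟨Finset.mem_univ _, h1, h2⟩)⟩
  by_contra hne
  exact he (hJ.mul_mem e y x hyx hne hy hx.1)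

end Chain

/-- Exactness of homogeneous maps may be checked on homogeneous elements. -/
theorem exists_preimage_of_homogeneous {V M N L : Type*} [AddCommGroup M]
    [AddCommGroup N] [AddCommGroup L] [Module (MvPolynomial V K) M] [Module (MvPolynomial V K) N]
    [Module (MvPolynomial V K) L] {grN : (V → ℤ) → AddSubgroup N} {grL : (V → ℤ) → AddSubgroup L}
    (hN : IsGrading K grN) (hL : IsGrading K grL) (f : M →ₗ[MvPolynomial V K] N)
    (g : N →ₗ[MvPolynomial V K] L) (hg : PreservesDegree grN grL g)
    (h : ∀ a, ∀ y ∈ grN a, g y = 0 → ∃ z, f z = y) {y : N} (hy : g y = 0) : ∃ z, f z = y := by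
  have h1 : (⨆ a, grN a ⊓ g.toAddMonoidHom.ker) ≤ (LinearMap.range f).toAddSubgroup :=
    iSup_le fun a z hz => h a z hz.1 hz.2
  exact h1 (mem_iSup_ker hN hL g hg hy)

theorem diff_diff (hJ : IsColored J) (k : ℕ) (y : G J (k + 2)) :
    diff J k (diff J (k + 1) y) = 0 := by
  obtain ⟨s, z, hz, rfl⟩ := (isGrading_grG hJ (k + 2)).exists_sum y
  rw [map_sum, map_sum]
  refine Finset.sum_eq_zero fun a _ => ?_
  obtain h0 | ⟨e, c, hc, h⟩ := eq_zero_or_exists_ofChain (hz a)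
  · rw [h0, map_zero, map_zero]
  · rw [h, diff_ofChain hc, diff_ofChain hc.boundary, ofChain_eq_zero_iff hJ hc.boundary.boundary]
    exact Or.inr fun v => boundary_boundary hc v

/-- In a degree in which the sequence does not vanish at the `(k + 1)`-st module there is a pivot,
since some nontrivial monomial `u` contributes; the contraction by it provides preimages of
cycles. -/
theorem exact_diff (hJ : IsColored J) (k : ℕ) : Function.Exact (diff J (k + 1)) (diff J k) := by
  intro y
  refine ⟨fun hy => ?_, fun ⟨z, hz⟩ => hz ▸ diff_diff hJ k z⟩
  refine exists_preimage_of_homogeneous (isGrading_grG hJ (k + 1)) (isGrading_grG hJ k) _ _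
    (preservesDegree_diff J k) (fun a y hy h0 => ?_) hy
  obtain rfl | ⟨e, c, hc, rfl⟩ := eq_zero_or_exists_ofChain hy
  · exact ⟨0, map_zero _⟩
  by_cases hz : ofChain J e (k + 1) c = 0
  · exact ⟨0, by rw [hz, map_zero]⟩
  rw [ofChain_eq_zero_iff hJ hc] at hz
  push Not at hz
  obtain ⟨he, u, hu⟩ := hz
  rw [diff_ofChain hc, ofChain_eq_zero_iff hJ hc.boundary] at h0
  have h0 := h0.resolve_left he
  obtain ⟨-, h2, h3⟩ := hc u hu
  obtain ⟨x, hx⟩ : ∃ x, IsPivot e x := by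
    refine exists_isPivot hJ he ?_
    obtain ⟨v, hv⟩ : ∃ v, u v ≠ 0 := by
      by_contra hv
      push Not at hv
      have : u = 0 := Finsupp.ext hv
      rw [this, map_zero] at h2
      omega
    rw [shiftExp_le_iff] at h3
    exact ⟨v, fun h => hv (Nat.le_zero.1 (h ▸ h3.1 v)), h3.2 v hv⟩
  refine ⟨ofChain J e (k + 2) (contraction x c), ?_⟩
  rw [diff_ofChain (hx.isChain_contraction hc)]
  congr 1
  exact funext (hx.boundary_contraction hc h0)

/-- A degree in which the canonical projection has a nonzero kernel belongs to a monomial of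
`J + L` outside `J`, so that it has a pivot. -/
theorem exact_diff_augG (hJ : IsColored J) : Function.Exact (diff J 0) (augG J) := by
  intro y
  refine ⟨fun hy => ?_, fun ⟨z, hz⟩ => hz ▸ augG_diff J z⟩
  refine exists_preimage_of_homogeneous (isGrading_grG hJ 0)
    (isGrading_cyclic hJ.isMonomialIdeal_sup_newIdeal 0) _ _
    (preservesDegree_augG J) (fun a y hy h0 => ?_) hy
  obtain rfl | ⟨e, c, hc, rfl⟩ := eq_zero_or_exists_ofChain hy
  · exact ⟨0, map_zero _⟩
  by_cases hz : ofChain J e 0 c = 0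
  · exact ⟨0, by rw [hz, map_zero]⟩
  rw [ofChain_eq_zero_iff hJ hc] at hz
  push Not at hz
  obtain ⟨he, u, hu⟩ := hz
  obtain rfl : u = 0 := (Finsupp.degree_eq_zero_iff u).1 (hc u hu).2.1
  obtain ⟨x, hx⟩ : ∃ x, IsPivot e x := by
    refine exists_isPivot hJ he (hJ.exists_of_mem_sup_newIdeal ?_ he)
    have hmem : monomial (e - shiftExp 0) (c 0) ∈ J ⊔ newIdeal K m :=
      Ideal.Quotient.eq_zero_iff_mem.1 h0
    have h1 : shiftExp (0 : Var m →₀ ℕ) = 0 := by simp [shiftExp, cSupp]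
    rw [h1, tsub_zero] at hmem
    exact hJ.isMonomialIdeal_sup_newIdeal _ hmem _ (by rwa [coeff_monomial, if_pos rfl])
  refine ⟨ofChain J e 1 (contraction x c), ?_⟩
  rw [diff_ofChain (hx.isChain_contraction hc)]
  funext v
  have hv : v.1 = 0 := (Finsupp.degree_eq_zero_iff v.1).1 v.2.2
  rw [ofChain, ofChain, hx.boundary_contraction_of_eq_zero hc (by rw [hv]; rfl)]

end Exactness

/-! ### Resolutions and Betti numbers -/

section Resolutions

variable {K : Type*} [Field K] {d : ℕ} {m : Fin d → ℕ} {J : Ideal (P' K m)}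

theorem grG_eq (k : ℕ) : grG J k =
    piGrading fun (u : MonCS m k) a => cyclicGrading (colonMon J u.1) 0 (a - shiftDeg u.1) := by
  rw [grG]
  congr 1
  funext u a
  rw [cyclicGrading, cyclicGrading, sub_zero]

/-- The modules of the sequence are resolved by direct sums of shifted resolutions. -/
theorem exists_directSum (k : ℕ)
    (R : ∀ u : MonCS m k, MinimalResolution K (cyclicGrading (colonMon J u.1) 0)) :
    ∃ S : MinimalResolution K (grG J k), S.complex =
      FreeComplex.directSum (fun u => (R u).complex) (fun u : MonCS m k => shiftDeg u.1) := by
  rw [grG_eq]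
  exact ⟨MinimalResolution.directSum R fun u => shiftDeg u.1, rfl⟩

theorem nonempty_minimalResolution_colonMon (hJ : IsColored J) (u : Var m →₀ ℕ) :
    Nonempty (MinimalResolution K (cyclicGrading (colonMon J u) 0)) :=
  exists_minimalResolution (isGrading_cyclic (hJ.isMonomialIdeal.colonMon u) 0)

/-- The multigraded Betti numbers of the modules of the sequence. -/
theorem rank_grG (hJ : IsColored J) {k : ℕ} (R : MinimalResolution K (grG J k)) (n : ℕ)
    (a : Var (succVec m) → ℤ) : R.complex.rank n a =
      ∑ u : MonCS m k, betti K (cyclicGrading (colonMon J u.1) 0) n (a - shiftDeg u.1) := by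
  have h := fun u : MonCS m k => nonempty_minimalResolution_colonMon hJ u.1
  obtain ⟨S, hS⟩ := exists_directSum k fun u => (h u).some
  rw [rank_eq_betti (isGrading_grG hJ k) R, ← rank_eq_betti (isGrading_grG hJ k) S, hS,
    FreeComplex.rank_directSum]
  exact Finset.sum_congr rfl fun u _ =>
    rank_eq_betti (isGrading_cyclic (hJ.isMonomialIdeal.colonMon u.1) 0) _ _ _

/-- All basis elements of a minimal resolution of the `k`-th module have total degree `k` in the
additional variables. -/
theorem sum_deg_new (hJ : IsColored J) {k : ℕ} (R : MinimalResolution K (grG J k)) (n : ℕ)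
    (b : R.complex.ι n) : ∑ i, R.complex.deg n b (new m i) = k := by
  have h := fun u : MonCS m k => nonempty_minimalResolution_colonMon hJ u.1
  obtain ⟨S, hS⟩ := exists_directSum k fun u => (h u).some
  have := R.complex.finite n
  have hne : R.complex.rank n (R.complex.deg n b) ≠ 0 :=
    Nat.card_ne_zero.2 ⟨⟨b, rfl⟩, inferInstance⟩
  rw [rank_eq_betti (isGrading_grG hJ k) R, ← rank_eq_betti (isGrading_grG hJ k) S, hS] at hne
  obtain ⟨⟨⟨u, b'⟩, hb'⟩⟩ := (Nat.card_ne_zero.1 hne).1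
  rw [← hb']
  have h1 : ∀ i, (FreeComplex.directSum (fun u => (h u).some.complex)
      (fun u : MonCS m k => shiftDeg u.1)).deg n ⟨u, b'⟩ (new m i) =
        if i ∈ cSupp u.1 then 1 else 0 := by
    intro i
    show (h u).some.complex.deg n b' (new m i) + shiftDeg u.1 (new m i) = _
    rw [hJ.deg_new_eq_zero, shiftDeg, expDeg, shiftExp_new, zero_add]
    split_ifs <;> rfl
  rw [Finset.sum_congr rfl fun i _ => h1 i, Finset.sum_boole, Finset.filter_mem_eq_inter,
    Finset.univ_inter, card_cSupp u.2.1, u.2.2]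

variable {R : ∀ k, MinimalResolution K (grG J k)}

theorem isResolution_of_iteratedCone (hJ : IsColored J) {C : FreeComplex K (Var (succVec m))}
    {ε : C.X 0 →ₗ[P' K m] G J 0} (h : IteratedCone (diff J) R d 0 C ε) :
    IsResolution C (cyclicGrading (J ⊔ newIdeal K m) 0) ((augG J).comp ε) where
  homogeneous a x hx := by
    obtain ⟨h0, -⟩ := h.resolves (exact_diff hJ) (fun k hk => subsingleton_G J hk)
    exact preservesDegree_augG J a _ (h0 a x hx)
  surjective := by
    obtain ⟨-, h1, -⟩ := h.resolves (exact_diff hJ) (fun k hk => subsingleton_G J hk)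
    exact (augG_surjective J).comp h1
  exact_zero x := by
    obtain ⟨-, -, -, h3⟩ := h.resolves (exact_diff hJ) (fun k hk => subsingleton_G J hk)
    exact (exact_diff_augG hJ (ε x)).trans (h3 x).symm
  exact_succ := (h.resolves (exact_diff hJ) (fun k hk => subsingleton_G J hk)).2.2.1

/-- Every iterated mapping cone is minimal: the total degrees in the additional variables of the
basis elements separate the resolutions of different modules of the sequence. -/
theorem isMinimal_of_iteratedCone (hJ : IsColored J) {C : FreeComplex K (Var (succVec m))}
    {ε : C.X 0 →ₗ[P' K m] G J 0} (h : IteratedCone (diff J) R d 0 C ε) : C.IsMinimal :=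
  (h.isMinimal (fun a => ∑ i, a (new m i)) fun k n b => sum_deg_new hJ (R k) n b).1

/-- The Betti numbers of `P' / (J + L)`: the minimal resolution by iterated mapping cones has the
resolutions of the modules of the sequence as its summands. -/
theorem betti_sup_newIdeal (hJ : IsColored J) (k : ℕ) (a : Var (succVec m) → ℤ) :
    betti K (cyclicGrading (J ⊔ newIdeal K m) 0) k a =
      ∑ j ∈ Finset.range (d + 1), ∑ u : MonCS m j,
        if j ≤ k then betti K (cyclicGrading (colonMon J u.1) 0) (k - j) (a - shiftDeg u.1)
        else 0 := by
  let R : ∀ k, MinimalResolution K (grG J k) := fun k =>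
    (exists_minimalResolution (isGrading_grG hJ k)).some
  obtain ⟨C, ε, h⟩ := exists_iteratedCone (R := R) (d := d) (isGrading_grG hJ)
    (preservesDegree_diff J) (exact_diff hJ) (fun k hk => subsingleton_G J hk) (Nat.zero_le d)
  rw [← rank_eq_betti (isGrading_cyclic hJ.isMonomialIdeal_sup_newIdeal 0)
    ⟨C, _, isResolution_of_iteratedCone hJ h, isMinimal_of_iteratedCone hJ h⟩]
  refine (h.rank_eq k a).trans (Finset.sum_congr ?_ fun j _ => ?_)
  · ext j
    simp only [Finset.mem_Icc, Finset.mem_range]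
    omega
  · rw [add_zero]
    split_ifs with hj
    · exact rank_grG hJ (R j) _ _
    · exact Finset.sum_const_zero.symm

end Resolutions

end Colored

end

theorem theorem5p9 {K : Type*} [Field K] {d : ℕ} (m : Fin d → ℕ) (I : Ideal (P K m))
    (hI : IsColorSquarefreeIdeal I) :
    -- (a) the exact sequence of graded modules `0 → G_d → ⋯ → G_0 → P'/(I' + ∑ x_{i,m_i+1} 𝔪_i) → 0`,
    -- whose maps are induced by those of the sequence for the ideal `𝔪₁^{[2]} + ⋯ + 𝔪_d^{[2]}`
    (((∀ k, IsGrading K (grG (primeIdeal I) k)) ∧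
      IsGrading K (cyclicGrading (primeIdeal I ⊔ newIdeal K m) 0) ∧
      (∀ k, PreservesDegree (grG (primeIdeal I) (k + 1)) (grG (primeIdeal I) k)
        (diff (primeIdeal I) k)) ∧
      PreservesDegree (grG (primeIdeal I) 0) (cyclicGrading (primeIdeal I ⊔ newIdeal K m) 0)
        (augG (primeIdeal I))) ∧
     ((∀ k, d < k → Subsingleton (G (primeIdeal I) k)) ∧
      (∀ k, Function.Exact (diff (primeIdeal I) (k + 1)) (diff (primeIdeal I) k)) ∧
      Function.Exact (diff (primeIdeal I) 0) (augG (primeIdeal I)) ∧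
      Function.Surjective (augG (primeIdeal I))) ∧
     (∀ k (x : G (polSquares K m) (k + 1)),
      projG (polSquares_le_primeIdeal I) k (diff (polSquares K m) k x) =
        diff (primeIdeal I) k (projG (polSquares_le_primeIdeal I) (k + 1) x))) ∧
    -- (b) iterated mapping cones give a minimal graded free resolution
    ((∀ k, Nonempty (MinimalResolution K (grG (primeIdeal I) k))) ∧
     ∀ R : ∀ k, MinimalResolution K (grG (primeIdeal I) k),
      (∃ (C : FreeComplex K (Var (succVec m))) (ε : C.X 0 →ₗ[P' K m] G (primeIdeal I) 0),
        IteratedCone (diff (primeIdeal I)) R d 0 C ε) ∧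
      ∀ (C : FreeComplex K (Var (succVec m))) (ε : C.X 0 →ₗ[P' K m] G (primeIdeal I) 0),
        IteratedCone (diff (primeIdeal I)) R d 0 C ε →
          IsResolution C (cyclicGrading (primeIdeal I ⊔ newIdeal K m) 0)
            ((augG (primeIdeal I)).comp ε) ∧
          C.IsMinimal) ∧
    -- (c) the multigraded Betti numbers; those of the modules involved are computed by every minimal
    -- graded free resolution
    ((∀ (R : MinimalResolution K (cyclicGrading (primeIdeal I ⊔ newIdeal K m) 0)) (k : ℕ)
        (a : Var (succVec m) → ℤ),
        R.complex.rank k a = betti K (cyclicGrading (primeIdeal I ⊔ newIdeal K m) 0) k a) ∧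
     (∀ (j : ℕ) (u : MonCS m j),
      Nonempty (MinimalResolution K (cyclicGrading (colonMon (primeIdeal I) u.1) 0)) ∧
      ∀ (R : MinimalResolution K (cyclicGrading (colonMon (primeIdeal I) u.1) 0)) (k : ℕ)
        (a : Var (succVec m) → ℤ),
        R.complex.rank k a = betti K (cyclicGrading (colonMon (primeIdeal I) u.1) 0) k a) ∧
     ∀ (k : ℕ) (a : Var (succVec m) → ℤ),
      betti K (cyclicGrading (primeIdeal I ⊔ newIdeal K m) 0) k a =
        ∑ j ∈ Finset.range (d + 1), ∑ u : MonCS m j,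
          if j ≤ k then
            betti K (cyclicGrading (colonMon (primeIdeal I) u.1) 0) (k - j) (a - shiftDeg u.1)
          else 0) := by
  have hJ := isColored_primeIdeal hI
  have hQ := isGrading_cyclic hJ.isMonomialIdeal_sup_newIdeal 0
  have hsub : ∀ k, d < k → Subsingleton (G (primeIdeal I) k) := fun k hk => subsingleton_G _ hk
  refine ⟨⟨⟨isGrading_grG hJ, hQ, preservesDegree_diff _, preservesDegree_augG _⟩,
    ⟨hsub, exact_diff hJ, exact_diff_augG hJ, augG_surjective _⟩,
    fun k => projG_diff (polSquares_le_primeIdeal I) k⟩,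
    ⟨fun k => exists_minimalResolution (isGrading_grG hJ k), fun R =>
      ⟨exists_iteratedCone (isGrading_grG hJ) (preservesDegree_diff _) (exact_diff hJ) hsub
        (Nat.zero_le d),
      fun C ε h => ⟨isResolution_of_iteratedCone hJ h, isMinimal_of_iteratedCone hJ h⟩⟩⟩,
    fun R => rank_eq_betti hQ R,
    fun j u => ⟨nonempty_minimalResolution_colonMon hJ u.1,
      fun R => rank_eq_betti (isGrading_cyclic (hJ.isMonomialIdeal.colonMon u.1) 0) R⟩,
    betti_sup_newIdeal hJ⟩
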